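/- **Setting.** Let $M>1$ be an integer, $m_r>0$ (renormalized mass), and let $\chi:\mathbb R\to[0,\infty)$ be smooth, supported in $[-\frac32,\frac32]$, with $\int\chi=1$. Put $\kappa=\mathbf 1_{[-5/2,5/2]}\star\chi$, $\kappa_j(x)=\kappa(M^{-2j}x)$ for $j\ge 0$, $\eta_0=\kappa_0$, $\eta_j=\kappa_j-\kappa_{j-1}$ for $j\ge1$. For an ultraviolet cutoff $j_{\max}\in\mathbb N$ let $\eta_{\ge j}=\sum_{l=j}^{j_{\max}}\eta_l$ for $j\ge 0$ (so $\eta_{\ge j_{\max}+1}=0$). *Bare melonic functions of the $T^4_5$ model.* For a bare coupling $g_b\in\mathbb C$ the bare wave function constant $Z_b$, the bare squared mass $m_b^2$ and the monochrome melonic self-energy $\Sigma$, regarded as a function of $s=n_c^2\in[0,\infty)$, are determined by $$\Sigma(s)=-g_bZ_b^2\sum_{p\in\mathbb Z^4}\frac{\kappa_{j_{\max}}(s+p^2)}{Z_b(s+p^2+m_b^2)-\Sigma(s)-\sum_{i=1}^4\Sigma(p_i^2)}\qquad(s\ge 0)$$ and by the renormalization conditions $m_r^2=Z_bm_b^2-5\Sigma(0)$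 and $1=Z_b-\Sigma'(0)$ (one-sided derivative at $s=0$). A *melonic family* is a choice of $Z_b,m_b^2,\Sigma(s)$ ($s\ge0$) analytic in $g_b$ in a common disc around $0$ and satisfying these equations there, the denominators being non-zero wherever $\kappa_{j_{\max}}(s+p^2)\ne0$. *Effective constants.* Let $\Sigma_{mr}(s)=\Sigma(s)-\Sigma(0)$. With $D(s,p)=Z_b(s+p^2)+m_r^2-\Sigma_{mr}(s)-\sum_i\Sigma_{mr}(p_i^2)$, define $$\Sigma^{\ge j}_{mr}(s)=-g_bZ_b^2\sum_{p\in\mathbb Z^4}\Big[\frac{\eta_{\ge j}(s+p^2)}{D(s,p)}-\frac{\eta_{\ge j}(p^2)}{D(0,p)}\Big],$$ $$G^{\ge j}_{mr}(s,p)=\frac{\eta_{\ge j}(s+p^2)}{Z_b(s+p^2)+m_r^2-\Sigma^{\ge j}_{mr}(s)-\sum_i\Sigma^{\ge j}_{mr}(p_i^2)},$$ $$\Gamma_4^{\ge j}(n,\bar n)=\frac{-g_bZ_b^2}{1+g_bZ_b^2\sum_{p\in\mathbb Z^4}G^{\ge j}_{mr}(n^2,p)\,G^{\ge j}_{mr}(\bar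 n^2,p)}\qquad(n,\bar n\in\mathbb Z).$$ For $-1\le j\le j_{\max}$ the effective wave function and coupling constants are $Z_j=Z_b-(\Sigma_{mr}^{\ge j+1})'(0)$ and $g_j$, defined by $-g_jZ_j^2=\Gamma_4^{\ge j+1}(0,0)$. They are functions of $g_b$. *Limiting coefficients.* With $h(x)=\kappa(x)-\kappa(M^2x)$ let $$\beta_2=-\int_{\mathbb R^4}\frac{2h(p^2)-h(p^2)^2-2h(p^2)h(M^{-2}p^2)}{p^4}\,d^4p,\qquad \beta_2^{UV}=-\int_{\mathbb R^4}\frac{2h(p^2)-h(p^2)^2}{p^4}\,d^4p .$$ **Theorem.** $\beta_2<0$ and $\beta_2^{UV}<0$. There are real numbers $\beta_j=\beta_j(j_{\max})$ and a constant $K$, depending only on $M,\chi,m_r$, such that: 1. For every $j_{\max}\ge0$ a melonic family exists, and for every melonic family and every $-1\le j\le j_{\max}$ the following hold: the derivative defining $Z_j$ exists for $g_b$ near $0$; $Z_j$ and $g_j$ are analytic functions of $g_b$ near $0$ with $Z_j(0)=1$, $g_j(0)=0$ and $\frac{dg_j}{dg_b}(0)\ne0$. For every $-1\le j\le j_{\max}-1$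 there is a function $f$, analytic near $0$ (in a domain that may depend on $j_{\max}$ and $j$), such that for all $g_b$ in a neighbourhood of $0$ $$g_{j+1}-g_j=\beta_j\,g_j^2+g_j^3f(g_j).$$ 2. For all $j_{\max}$ and all $-1\le j\le j_{\max}-2$: $|\beta_j-\beta_2|\le K M^{-j}$. 3. For all $j_{\max}$ and $j=j_{\max}-1$: $|\beta_{j}-\beta_2^{UV}|\le K M^{-j}$. In particular the model is asymptotically free at one loop. -/

import Mathlib

open MeasureTheory Filter Topology Set

noncomputable section

namespace T45

/-! ### Cutoffs and slices -/

/-- A smooth nonnegative bump of total mass one, supported in `[-3/2, 3/2]`. -/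
structure IsBump (χ : ℝ → ℝ) : Prop where
  smooth : ContDiff ℝ (⊤ : ℕ∞) χ
  nonneg : ∀ x, 0 ≤ χ x
  support_subset : tsupport χ ⊆ Icc (-(3 / 2)) (3 / 2)
  integral_eq_one : ∫ x, χ x = 1

/-- The cutoff profile `κ = 1_{[-5/2, 5/2]} ⋆ χ`. -/
def kappa (χ : ℝ → ℝ) : ℝ → ℝ :=
  convolution (indicator (Icc (-(5 / 2)) (5 / 2)) (fun _ => (1 : ℝ))) χ
    (ContinuousLinearMap.mul ℝ ℝ) volume

/-- The cutoff at scale `j`: `κ_j (x) = κ (M^{-2j} x)`, where `x` stands for a squared momentum. -/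
def kappaAt (M : ℕ) (χ : ℝ → ℝ) (j : ℤ) (x : ℝ) : ℝ :=
  kappa χ ((M : ℝ) ^ (-2 * j) * x)

/-- The slice functions: `η_0 = κ_0` and `η_j = κ_j - κ_{j-1}` for `j ≥ 1`. -/
def eta (M : ℕ) (χ : ℝ → ℝ) (j : ℤ) (x : ℝ) : ℝ :=
  if j = 0 then kappaAt M χ 0 x else kappaAt M χ j x - kappaAt M χ (j - 1) x

/-- `η_{≥ j} = ∑_{l = j}^{jmax} η_l`, for `0 ≤ j` (zero when `j > jmax`). -/
def etaGe (M : ℕ) (χ : ℝ → ℝ) (jmax : ℕ) (j : ℤ) (x : ℝ) : ℝ :=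
  ∑ l ∈ Finset.Icc j (jmax : ℤ), eta M χ l x

/-! ### The bare melonic functions

A momentum in `ℤ⁵` is split into its component of a distinguished colour `c` and the four others,
`p : Fin 4 → ℤ`. Functions of the component of colour `c` only depend on its square `s ≥ 0`; they
are extended from squares of integers to all real `s ≥ 0` by the equations that define them, which
gives a meaning to the derivative with respect to the squared momentum at zero. -/

/-- The squared length of a momentum in `ℤ⁴`. -/
def momSq (p : Fin 4 → ℤ) : ℝ := ∑ i, (p i : ℝ) ^ 2

/-- Bare wave function constant, bare squared mass, and bare monochrome melonic self-energy (as a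
function of the squared momentum), at one value of the bare coupling. -/
structure BareData where
  Z : ℂ
  massSq : ℂ
  Sigma : ℝ → ℂ

/-- The bare 1PI melonic two-point function `C_b⁻¹ - Σ`, with
`C_b⁻¹(n) = Z_b (n² + m_b²)` and `Σ(n) = ∑_c Σ^c(n_c)`. -/
def BareData.gammaTwo (B : BareData) (s : ℝ) (p : Fin 4 → ℤ) : ℂ :=
  B.Z * (((s + momSq p : ℝ) : ℂ) + B.massSq) - (B.Sigma s + ∑ i, B.Sigma ((p i : ℝ) ^ 2))

/-- The bare connected melonic two-point function with ultraviolet cutoff `jmax`. -/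
def BareData.twoPoint (M : ℕ) (χ : ℝ → ℝ) (jmax : ℕ) (B : BareData) (s : ℝ) (p : Fin 4 → ℤ) : ℂ :=
  (kappaAt M χ jmax (s + momSq p) : ℂ) / B.gammaTwo s p

/-- At bare coupling `g`, the bare data `B` solve the melonic self-energy equation, with renormalized
mass `m_r` and renormalized wave function constant `1`. -/
structure BareData.IsSolution (M : ℕ) (χ : ℝ → ℝ) (jmax : ℕ) (mr : ℝ) (g : ℂ) (B : BareData) :
    Prop where
  /-- No propagator that survives the cutoff has a vanishing denominator. -/
  gammaTwo_ne_zero : ∀ s : ℝ, 0 ≤ s → ∀ p : Fin 4 → ℤ,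
    kappaAt M χ jmax (s + momSq p) ≠ 0 → B.gammaTwo s p ≠ 0
  /-- `Σ^c(n_c) = - g_b Z_b² ∑_{p ∈ ℤ⁵} δ_{p_c, n_c} G(p)`. -/
  selfEnergy_eq : ∀ s : ℝ, 0 ≤ s →
    B.Sigma s = -g * B.Z ^ 2 * ∑' p : Fin 4 → ℤ, B.twoPoint M χ jmax s p
  /-- `m_r² = Z_b m_b² - Σ(0)`, where `Σ(0)` is the sum over the five colours. -/
  mass_renormalization : (mr : ℂ) ^ 2 = B.Z * B.massSq - 5 * B.Sigma 0
  /-- `1 = Z_b - ∂Σ^c/∂n_c² (0)`. -/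
  wave_renormalization : HasDerivWithinAt B.Sigma (B.Z - 1) (Ici 0) 0

/-- A perturbative solution: bare data depending analytically on the bare coupling in some
disc around zero (whose radius may depend on everything else) and solving the equations there. -/
def IsMelonicFamily (M : ℕ) (χ : ℝ → ℝ) (jmax : ℕ) (mr : ℝ) (B : ℂ → BareData) : Prop :=
  ∃ r : ℝ, 0 < r ∧
    AnalyticOnNhd ℂ (fun g => (B g).Z) (Metric.ball 0 r) ∧
    AnalyticOnNhd ℂ (fun g => (B g).massSq) (Metric.ball 0 r) ∧
    (∀ s : ℝ, 0 ≤ s → AnalyticOnNhd ℂ (fun g => (B g).Sigma s) (Metric.ball 0 r)) ∧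
    ∀ g ∈ Metric.ball (0 : ℂ) r, (B g).IsSolution M χ jmax mr g

/-! ### Mass renormalization and effective constants -/

/-- The mass-renormalized monochrome self-energy `Σ_mr^c(n_c) = Σ^c(n_c) - Σ^c(0)`. -/
def BareData.sigmaMr (B : BareData) (s : ℝ) : ℂ := B.Sigma s - B.Sigma 0

/-- The denominator `Z_b n² + m_r² - ∑_c S(n_c)` of a mass-renormalized two-point function with
self-energy `S`. -/
def BareData.denomMr (B : BareData) (mr : ℝ) (S : ℝ → ℂ) (s : ℝ) (p : Fin 4 → ℤ) : ℂ :=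
  B.Z * ((s + momSq p : ℝ) : ℂ) + (mr : ℂ) ^ 2 - (S s + ∑ i, S ((p i : ℝ) ^ 2))

/-- The part of the mass-renormalized monochrome self-energy with scales `≥ j`:
`- g_b Z_b² ∑_p η_{≥ j}(p²) (δ_{p_c, n_c} - δ_{p_c, 0}) / (Z_b p² + m_r² - ∑_{c'} Σ_mr(p_{c'}))`. -/
def BareData.sigmaMrGe (M : ℕ) (χ : ℝ → ℝ) (jmax : ℕ) (mr : ℝ) (g : ℂ) (B : BareData) (j : ℤ)
    (s : ℝ) : ℂ :=
  -g * B.Z ^ 2 * ∑' p : Fin 4 → ℤ,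
    ((etaGe M χ jmax j (s + momSq p) : ℂ) / B.denomMr mr B.sigmaMr s p -
      (etaGe M χ jmax j (0 + momSq p) : ℂ) / B.denomMr mr B.sigmaMr 0 p)

/-- The mass-renormalized melonic two-point function with scales `≥ j`. -/
def BareData.twoPointMrGe (M : ℕ) (χ : ℝ → ℝ) (jmax : ℕ) (mr : ℝ) (g : ℂ) (B : BareData) (j : ℤ)
    (s : ℝ) (p : Fin 4 → ℤ) : ℂ :=
  (etaGe M χ jmax j (s + momSq p) : ℂ) /
    B.denomMr mr (B.sigmaMrGe M χ jmax mr g j) s p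

/-- The monochrome 1PI melonic four-point function with scales `≥ j`, at `(n_c, n̄_c)`. -/
def BareData.gammaFourGe (M : ℕ) (χ : ℝ → ℝ) (jmax : ℕ) (mr : ℝ) (g : ℂ) (B : BareData) (j : ℤ)
    (n n' : ℤ) : ℂ :=
  (-g * B.Z ^ 2) / (1 + g * B.Z ^ 2 * ∑' p : Fin 4 → ℤ,
    B.twoPointMrGe M χ jmax mr g j ((n : ℝ) ^ 2) p *
      B.twoPointMrGe M χ jmax mr g j ((n' : ℝ) ^ 2) p)

/-- The effective wave function constant `Z_j = Z_b - ∂Σ_mr^{≥ j+1}/∂n_c² (0)`. -/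
def effZ (M : ℕ) (χ : ℝ → ℝ) (jmax : ℕ) (mr : ℝ) (B : ℂ → BareData) (j : ℤ) (g : ℂ) : ℂ :=
  (B g).Z - derivWithin ((B g).sigmaMrGe M χ jmax mr g (j + 1)) (Ici 0) 0

/-- The effective coupling constant `g_j`, defined by `- g_j Z_j² = Γ₄^{≥ j+1}(0, 0)`. -/
def effG (M : ℕ) (χ : ℝ → ℝ) (jmax : ℕ) (mr : ℝ) (B : ℂ → BareData) (j : ℤ) (g : ℂ) : ℂ :=
  -(B g).gammaFourGe M χ jmax mr g (j + 1) 0 0 / effZ M χ jmax mr B j g ^ 2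

/-! ### The limiting coefficients -/

/-- `h (x) = κ (x) - κ (M² x)`, so that `η_j (x) = h (M^{-2j} x)` for `j ≥ 1`. -/
def hFun (M : ℕ) (χ : ℝ → ℝ) (x : ℝ) : ℝ := kappa χ x - kappa χ ((M : ℝ) ^ 2 * x)

/-- `β₂ = -∫_{ℝ⁴} (2 h(p²) - h(p²)² - 2 h(p²) h(M⁻² p²)) / p⁴ d⁴p`. -/
def betaTwo (M : ℕ) (χ : ℝ → ℝ) : ℝ :=
  -∫ p : EuclideanSpace ℝ (Fin 4),
    (2 * hFun M χ (‖p‖ ^ 2) - hFun M χ (‖p‖ ^ 2) ^ 2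
      - 2 * hFun M χ (‖p‖ ^ 2) * hFun M χ ((M : ℝ) ^ (-2 : ℤ) * ‖p‖ ^ 2)) / ‖p‖ ^ 4

/-- The analogue of `β₂` for the last step `j = jmax - 1`, where there is no slice `jmax + 1`:
`-∫_{ℝ⁴} (2 h(p²) - h(p²)²) / p⁴ d⁴p`. -/
def betaTwoUV (M : ℕ) (χ : ℝ → ℝ) : ℝ :=
  -∫ p : EuclideanSpace ℝ (Fin 4),
    (2 * hFun M χ (‖p‖ ^ 2) - hFun M χ (‖p‖ ^ 2) ^ 2) / ‖p‖ ^ 4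

end T45

end

noncomputable section

namespace T45

/-! ### The cutoff profile -/

section Cutoff

variable {M : ℕ} {χ : ℝ → ℝ}

/-! At a fixed ultraviolet cutoff only the finitely many momenta in `latticeBox` contribute, so
every sum is finite and the theorem has an algebraic half and an asymptotic half.

Algebraic half. Eliminating the bare mass by the mass condition turns the melonic equations into `x
= (1, 0) + g U(x)` for `x = (Z, Σ)` in `ℂ × C([0, S], ℂ)`, with `U` analytic near `(1, 0)`. The
analytic implicit function theorem gives a family (`exists_melonicFamily`). Any family is the free
theory at `g = 0`, and the wave function condition says that all full denominators have slope `1` in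
`s` at `0`. Differentiating the self-energies then gives `g_j = g_b U_j(g_b)` with `U_j(0) = 1` and
`U_j'(0)` the explicit lattice sum `oneLoop` (`IsMelonicFamily.effective_expansion`). Two series
tangent to the identity differ by the difference of their quadratic coefficients plus a cubic
remainder, and `g_j` can replace `g_b` as the variable (`exists_flow_remainder`). Hence `β_j` is a
difference of consecutive `oneLoop` values.

Asymptotic half. That difference is a sum over the single slice `j + 1`; its only dependence on
higher slices is through the overlap with slice `j + 2`, absent at the last step. With `L = M ^ (j +
1)` the summand is `L⁻⁴` times a function of `p / L`, up to a mass shift `m_r² / L²`. In dimension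
four this is a Riemann sum with error `O(1 / L)` (`exists_slice_sum_bound`). In the limit the term
containing `h'` is a radial total derivative and integrates to zero (`integral_deriv_hFun`), leaving
the stated integrals. They are negative because two adjacent slices sum to at most one, which bounds
the numerator by `-h²` (`slicePoly_le`). -/

lemma IsBump.hasCompactSupport (hχ : IsBump χ) : HasCompactSupport χ :=
  HasCompactSupport.of_support_subset_isCompact isCompact_Icc
    ((subset_tsupport χ).trans hχ.support_subset)

lemma IsBump.integrable (hχ : IsBump χ) : Integrable χ :=
  hχ.smooth.continuous.integrable_of_hasCompactSupport hχ.hasCompactSupport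

/-- The open support lies in the interior of the interval, so `χ` also vanishes at `±3/2`. This is
what makes `kappa_eq_zero` valid at the endpoint `4`. -/
lemma IsBump.eq_zero (hχ : IsBump χ) {x : ℝ} (hx : 3 / 2 ≤ |x|) : χ x = 0 := by
  by_contra h
  have hopen : IsOpen (Function.support χ) := hχ.smooth.continuous.isOpen_support
  have h1 : Function.support χ ⊆ interior (Icc (-(3 / 2)) (3 / 2)) :=
    interior_maximal ((subset_tsupport χ).trans hχ.support_subset) hopen
  have h2 := h1 (Function.mem_support.2 h)
  rw [interior_Icc] at h2
  have : |x| < 3 / 2 := abs_lt.2 h2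
  linarith

lemma kappa_eq_setIntegral (χ : ℝ → ℝ) (x : ℝ) :
    kappa χ x = ∫ t in Icc (-(5 / 2)) (5 / 2), χ (x - t) := by
  rw [kappa, convolution, ← integral_indicator measurableSet_Icc]
  congr 1
  ext t
  by_cases h : t ∈ Icc (-(5 / 2) : ℝ) (5 / 2) <;> simp [h]

lemma kappa_contDiff (hχ : IsBump χ) : ContDiff ℝ (⊤ : ℕ∞) (kappa χ) := by
  refine HasCompactSupport.contDiff_convolution_right _ hχ.hasCompactSupport ?_ hχ.smooth
  exact (locallyIntegrable_const (1 : ℝ)).indicator measurableSet_Icc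

lemma kappa_nonneg (hχ : IsBump χ) (x : ℝ) : 0 ≤ kappa χ x := by
  rw [kappa_eq_setIntegral]
  exact integral_nonneg fun t => hχ.nonneg _

lemma kappa_le_one (hχ : IsBump χ) (x : ℝ) : kappa χ x ≤ 1 := by
  rw [kappa_eq_setIntegral, ← hχ.integral_eq_one, ← integral_sub_left_eq_self χ volume x]
  exact setIntegral_le_integral (hχ.integrable.comp_sub_left x)
    (Eventually.of_forall fun t => hχ.nonneg _)

/-- Since `5/2 = 1 + 3/2`, the whole mass of `χ` recentred at `x` falls inside the window; it misses
the window once `x ≥ 4 = 5/2 + 3/2`. The radii `1` and `4` recur throughout. -/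
lemma kappa_eq_one (hχ : IsBump χ) {x : ℝ} (hx : |x| ≤ 1) : kappa χ x = 1 := by
  rw [kappa_eq_setIntegral, ← hχ.integral_eq_one, ← integral_sub_left_eq_self χ volume x]
  refine setIntegral_eq_integral_of_forall_compl_eq_zero fun t ht => hχ.eq_zero ?_
  have : 5 / 2 < |t| := by
    by_contra h
    exact ht (abs_le.1 (not_lt.1 h))
  have := abs_sub_abs_le_abs_sub t x
  rw [abs_sub_comm]
  linarith

lemma kappa_eq_zero (hχ : IsBump χ) {x : ℝ} (hx : 4 ≤ x) : kappa χ x = 0 := by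
  rw [kappa_eq_setIntegral]
  refine setIntegral_eq_zero_of_forall_eq_zero fun t ht => hχ.eq_zero ?_
  have := ht.2
  exact le_trans (by linarith) (le_abs_self _)

lemma hFun_contDiff (hχ : IsBump χ) : ContDiff ℝ (⊤ : ℕ∞) (hFun M χ) :=
  (kappa_contDiff hχ).sub ((kappa_contDiff hχ).comp (contDiff_const.mul contDiff_id))

lemma four_le_sq (hM : 1 < M) : (4 : ℝ) ≤ (M : ℝ) ^ 2 := by
  have : (2 : ℝ) ≤ M := by exact_mod_cast hM
  nlinarith

/-- Monotonicity of `κ` is not needed: since `M² ≥ 4`, at every `x ≥ 0` either `κ(x) = 1` or `κ(M²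
x) = 0`. -/
lemma hFun_nonneg (hM : 1 < M) (hχ : IsBump χ) {x : ℝ} (hx : 0 ≤ x) : 0 ≤ hFun M χ x := by
  have hM' := four_le_sq hM
  rcases le_total x 1 with h | h
  · rw [hFun, kappa_eq_one hχ (abs_le.2 ⟨by linarith, h⟩)]
    linarith [kappa_le_one hχ ((M : ℝ) ^ 2 * x)]
  · rw [hFun, kappa_eq_zero hχ (x := (M : ℝ) ^ 2 * x) (by nlinarith)]
    linarith [kappa_nonneg hχ x]

lemma hFun_one (hM : 1 < M) (hχ : IsBump χ) : hFun M χ 1 = 1 := by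
  rw [hFun, kappa_eq_one hχ (by simp), kappa_eq_zero hχ (by linarith [four_le_sq hM])]
  simp

lemma hFun_eq_zero_of_small (hM : 1 < M) (hχ : IsBump χ) {x : ℝ}
    (hx : |x| ≤ ((M : ℝ) ^ 2)⁻¹) : hFun M χ x = 0 := by
  have hM' := four_le_sq hM
  have h0 : (0 : ℝ) < (M : ℝ) ^ 2 := by linarith
  have h1 : ((M : ℝ) ^ 2)⁻¹ ≤ 1 := inv_le_one_of_one_le₀ (by linarith)
  rw [hFun, kappa_eq_one hχ (hx.trans h1), kappa_eq_one hχ, sub_self]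
  rw [abs_mul, abs_of_pos h0]
  calc (M : ℝ) ^ 2 * |x| ≤ (M : ℝ) ^ 2 * ((M : ℝ) ^ 2)⁻¹ := by gcongr
    _ = 1 := mul_inv_cancel₀ h0.ne'

lemma hFun_eq_zero_of_large (hM : 1 < M) (hχ : IsBump χ) {x : ℝ} (hx : 4 ≤ x) :
    hFun M χ x = 0 := by
  have hM' := four_le_sq hM
  rw [hFun, kappa_eq_zero hχ hx, kappa_eq_zero hχ (by nlinarith), sub_self]

/-- The two slices telescope to `κ(M⁻² x) - κ(M² x)`. -/
lemma hFun_add_le_one (hM : 1 < M) (hχ : IsBump χ) (x : ℝ) :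
    hFun M χ x + hFun M χ ((M : ℝ) ^ (-2 : ℤ) * x) ≤ 1 := by
  have h0 : (0 : ℝ) < (M : ℝ) ^ 2 := by linarith [four_le_sq hM]
  have : (M : ℝ) ^ 2 * ((M : ℝ) ^ (-2 : ℤ) * x) = x := by
    rw [zpow_neg, zpow_ofNat, mul_inv_cancel_left₀ h0.ne']
  simp only [hFun, this]
  have := kappa_le_one hχ ((M : ℝ) ^ (-2 : ℤ) * x)
  have := kappa_nonneg hχ ((M : ℝ) ^ 2 * x)
  linarith

/-! ### The slices -/

lemma kappaAt_contDiff (hχ : IsBump χ) (j : ℤ) : ContDiff ℝ (⊤ : ℕ∞) (kappaAt M χ j) :=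
  (kappa_contDiff hχ).comp (contDiff_const.mul contDiff_id)

lemma eta_contDiff (hχ : IsBump χ) (j : ℤ) : ContDiff ℝ (⊤ : ℕ∞) (eta M χ j) := by
  unfold eta
  split_ifs
  · exact kappaAt_contDiff hχ 0
  · exact (kappaAt_contDiff hχ j).sub (kappaAt_contDiff hχ (j - 1))

lemma etaGe_contDiff (hχ : IsBump χ) (jmax : ℕ) (j : ℤ) :
    ContDiff ℝ (⊤ : ℕ∞) (etaGe M χ jmax j) := by
  unfold etaGe
  exact ContDiff.sum fun l _ => eta_contDiff hχ l

lemma etaGe_eq_add {jmax : ℕ} {j : ℤ} (hj : j ≤ jmax) (x : ℝ) :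
    etaGe M χ jmax j x = eta M χ j x + etaGe M χ jmax (j + 1) x := by
  unfold etaGe
  rw [← Finset.insert_Icc_add_one_left_eq_Icc hj, Finset.sum_insert (by simp)]

lemma etaGe_of_lt {jmax : ℕ} {j : ℤ} (hj : (jmax : ℤ) < j) (x : ℝ) : etaGe M χ jmax j x = 0 := by
  unfold etaGe
  rw [Finset.Icc_eq_empty (by omega), Finset.sum_empty]

lemma etaGe_zero (jmax : ℕ) (x : ℝ) : etaGe M χ jmax 0 x = kappaAt M χ jmax x := by
  induction jmax with
  | zero => simp [etaGe, eta]
  | succ n ih =>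
    unfold etaGe at ih ⊢
    push_cast
    rw [← Finset.insert_Icc_right_eq_Icc_add_one (by omega), Finset.sum_insert (by simp), ih, eta,
      if_neg (by omega)]
    simp

lemma etaGe_succ {jmax : ℕ} (j : ℕ) (hj : j ≤ jmax) (x : ℝ) :
    etaGe M χ jmax (j + 1) x = kappaAt M χ jmax x - kappaAt M χ j x := by
  induction j with
  | zero =>
    have := etaGe_eq_add (M := M) (χ := χ) (jmax := jmax) (j := 0) (by omega) x
    rw [etaGe_zero, eta, if_pos rfl] at this
    simp only [Nat.cast_zero]
    linarith
  | succ n ih =>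
    have := etaGe_eq_add (M := M) (χ := χ) (jmax := jmax) (j := n + 1) (by omega) x
    rw [ih (by omega), eta, if_neg (by omega)] at this
    push_cast at this ⊢
    simp only [add_sub_cancel_right] at this
    linarith

end Cutoff

/-! ### Negativity of the limiting coefficients -/

section Limit

/-- The singularity is only apparent: the quotient is identically zero near the origin. The infrared
cutoff of a slice thus keeps its massless limit smooth. -/
lemma contDiff_div_pow {n : WithTop ℕ∞} {q : ℝ → ℝ} (hq : ContDiff ℝ n q) {δ : ℝ} (hδ : 0 < δ)
    (h0 : ∀ x, |x| ≤ δ → q x = 0) (m : ℕ) : ContDiff ℝ n fun t => q t / t ^ m := by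
  rw [contDiff_iff_contDiffAt]
  intro x
  by_cases hx : x = 0
  · subst hx
    refine (contDiffAt_const (c := (0 : ℝ))).congr_of_eventuallyEq ?_
    filter_upwards [Metric.ball_mem_nhds (0 : ℝ) hδ] with y hy
    rw [h0 y (by simpa using (mem_ball_zero_iff.1 hy).le), zero_div]
  · exact hq.contDiffAt.div (contDiffAt_id.pow m) (pow_ne_zero m hx)

lemma hasCompactSupport_comp_norm_sq {E : Type*} [NormedAddCommGroup E] [ProperSpace E]
    {Φ : ℝ → ℝ} {R : ℝ} (hR : ∀ t, R ≤ t → Φ t = 0) :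
    HasCompactSupport fun p : E => Φ (‖p‖ ^ 2) := by
  refine HasCompactSupport.intro (isCompact_closedBall (0 : E) (max R 1)) fun p hp => hR _ ?_
  have h : max R 1 < ‖p‖ := by simpa using hp
  have h1 := le_max_left R 1
  have h2 := le_max_right R 1
  nlinarith

lemma integral_pos_comp_norm_sq {Φ : ℝ → ℝ} (hΦ : Continuous Φ) {R : ℝ}
    (hR : ∀ t, R ≤ t → Φ t = 0) (hnn : ∀ t, 0 ≤ t → 0 ≤ Φ t) (h1 : Φ 1 ≠ 0) :
    0 < ∫ p : EuclideanSpace ℝ (Fin 4), Φ (‖p‖ ^ 2) := by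
  refine Continuous.integral_pos_of_hasCompactSupport_nonneg_nonzero
    (x := EuclideanSpace.single 0 1) (by fun_prop)
    (hasCompactSupport_comp_norm_sq hR) (fun p => hnn _ (by positivity)) ?_
  simpa using h1

variable {M : ℕ} {χ : ℝ → ℝ}

/-- The integrand of the limiting coefficients as a function of `t = p²`, with the
contribution `θ h` of the next slice. -/
def slicePoly (M : ℕ) (χ : ℝ → ℝ) (θ : ℝ) (t : ℝ) : ℝ :=
  hFun M χ t ^ 2 + 2 * θ * hFun M χ t * hFun M χ ((M : ℝ) ^ (-2 : ℤ) * t) - 2 * hFun M χ t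

lemma slicePoly_contDiff (hχ : IsBump χ) (θ : ℝ) : ContDiff ℝ (⊤ : ℕ∞) (slicePoly M χ θ) := by
  have h := hFun_contDiff (M := M) hχ
  have h' : ContDiff ℝ (⊤ : ℕ∞) fun t => hFun M χ ((M : ℝ) ^ (-2 : ℤ) * t) :=
    h.comp (contDiff_const.mul contDiff_id)
  exact ((h.pow 2).add ((contDiff_const.mul h).mul h')).sub (contDiff_const.mul h)

lemma slicePoly_eq_zero {t : ℝ} (θ : ℝ) (ht : hFun M χ t = 0) : slicePoly M χ θ t = 0 := by
  simp [slicePoly, ht]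

/-- With `h⁺` the next slice, the polynomial is `h (h + 2 θ h⁺ - 2)`, and `θ h⁺ ≤ 1 - h` bounds the
bracket by `-h`. -/
lemma slicePoly_le (hM : 1 < M) (hχ : IsBump χ) {θ : ℝ} (h1 : θ ≤ 1) {t : ℝ}
    (ht : 0 ≤ t) : slicePoly M χ θ t ≤ -hFun M χ t ^ 2 := by
  have a := hFun_nonneg hM hχ ht
  have b : 0 ≤ hFun M χ ((M : ℝ) ^ (-2 : ℤ) * t) := hFun_nonneg hM hχ (by positivity)
  have c := hFun_add_le_one hM hχ t
  rw [slicePoly]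
  have d : θ * hFun M χ ((M : ℝ) ^ (-2 : ℤ) * t) ≤ 1 - hFun M χ t := by nlinarith
  nlinarith

lemma inv_sq_pos (hM : 1 < M) : 0 < ((M : ℝ) ^ 2)⁻¹ := by
  have := four_le_sq hM
  positivity

lemma slicePoly_integral_neg (hM : 1 < M) (hχ : IsBump χ) {θ : ℝ} (h1 : θ ≤ 1) :
    ∫ p : EuclideanSpace ℝ (Fin 4), slicePoly M χ θ (‖p‖ ^ 2) / (‖p‖ ^ 2) ^ 2 < 0 := by
  have hc := contDiff_div_pow (slicePoly_contDiff (M := M) hχ θ) (inv_sq_pos hM)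
    (fun x hx => slicePoly_eq_zero θ (hFun_eq_zero_of_small hM hχ hx)) 2
  have := integral_pos_comp_norm_sq (Φ := fun t => -(slicePoly M χ θ t / t ^ 2))
    hc.continuous.neg (R := 4)
    (fun t ht => by rw [slicePoly_eq_zero θ (hFun_eq_zero_of_large hM hχ ht)]; simp)
    (fun t ht => by
      rw [← neg_div]
      have := slicePoly_le hM hχ h1 ht
      have := sq_nonneg (hFun M χ t)
      exact div_nonneg (by linarith) (by positivity))
    (by
      have := slicePoly_le hM hχ h1 zero_le_one
      rw [hFun_one hM hχ] at this
      have : slicePoly M χ θ 1 ≠ 0 := by linarith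
      simpa using this)
  rw [integral_neg] at this
  linarith

lemma betaTwo_eq (M : ℕ) (χ : ℝ → ℝ) : betaTwo M χ =
    ∫ p : EuclideanSpace ℝ (Fin 4), slicePoly M χ 1 (‖p‖ ^ 2) / (‖p‖ ^ 2) ^ 2 := by
  rw [betaTwo, ← integral_neg]
  congr 1 with p
  rw [slicePoly, ← neg_div]
  ring

lemma betaTwoUV_eq (M : ℕ) (χ : ℝ → ℝ) : betaTwoUV M χ =
    ∫ p : EuclideanSpace ℝ (Fin 4), slicePoly M χ 0 (‖p‖ ^ 2) / (‖p‖ ^ 2) ^ 2 := by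
  rw [betaTwoUV, ← integral_neg]
  congr 1 with p
  rw [slicePoly, ← neg_div]
  ring

/-! ### The derivative term integrates to zero -/

lemma deriv_hFun_eq_zero_of_small (hM : 1 < M) (hχ : IsBump χ) {t : ℝ}
    (ht : |t| < ((M : ℝ) ^ 2)⁻¹) : deriv (hFun M χ) t = 0 := by
  have : hFun M χ =ᶠ[𝓝 t] fun _ => 0 := by
    filter_upwards [continuous_abs.continuousAt.eventually_lt continuousAt_const ht] with y hy
    exact hFun_eq_zero_of_small hM hχ (le_of_lt hy)
  rw [this.deriv_eq]
  simp

lemma deriv_hFun_eq_zero_of_large (hM : 1 < M) (hχ : IsBump χ) {t : ℝ}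
    (ht : 4 < t) : deriv (hFun M χ) t = 0 := by
  have : hFun M χ =ᶠ[𝓝 t] fun _ => 0 := by
    filter_upwards [lt_mem_nhds ht] with y hy
    exact hFun_eq_zero_of_large hM hχ (le_of_lt hy)
  rw [this.deriv_eq]
  simp

lemma deriv_hFun_contDiff (hχ : IsBump χ) : ContDiff ℝ 1 (deriv (hFun M χ)) := by
  have : ContDiff ℝ (1 + 1) (hFun M χ) := (hFun_contDiff hχ).of_le (by norm_cast)
  exact (contDiff_succ_iff_deriv.1 this).2.2

/-- In polar coordinates the radial density is `r³ h'(r²) / r² = r h'(r²)`, the derivative of `h(r²)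
/ 2`, and `h` vanishes near zero and near infinity. The cancellation of powers is special to
dimension four. -/
lemma integral_deriv_hFun (hM : 1 < M) (hχ : IsBump χ) :
    ∫ p : EuclideanSpace ℝ (Fin 4), deriv (hFun M χ) (‖p‖ ^ 2) / ‖p‖ ^ 2 = 0 := by
  have h := integral_fun_norm_addHaar (volume : Measure (EuclideanSpace ℝ (Fin 4)))
    fun r => deriv (hFun M χ) (r ^ 2) / r ^ 2
  rw [h]
  have hder : ∀ y : ℝ, HasDerivAt (fun y => hFun M χ (y ^ 2) / 2)
      (y * deriv (hFun M χ) (y ^ 2)) y := by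
    intro y
    have h1 : HasDerivAt (hFun M χ) (deriv (hFun M χ) (y ^ 2)) (y ^ 2) :=
      ((hFun_contDiff hχ).differentiable (by simp)).differentiableAt.hasDerivAt
    have := (HasDerivAt.comp (h₂ := hFun M χ) (h := fun x => x ^ 2) y h1
      (hasDerivAt_pow 2 y)).div_const 2
    refine this.congr_deriv ?_
    push_cast
    ring
  have hcont : Continuous fun y : ℝ => y * deriv (hFun M χ) (y ^ 2) :=
    continuous_id.mul ((deriv_hFun_contDiff hχ).continuous.comp (continuous_pow 2))
  have hsupp : HasCompactSupport fun y : ℝ => y * deriv (hFun M χ) (y ^ 2) := by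
    refine HasCompactSupport.intro (isCompact_Icc (a := (-2 : ℝ)) (b := 2)) fun y hy => ?_
    have : 2 < |y| := by
      by_contra hh
      exact hy (abs_le.1 (not_lt.1 hh))
    rw [deriv_hFun_eq_zero_of_large hM hχ, mul_zero]
    rw [← sq_abs]
    nlinarith
  have hint := integral_Ioi_of_hasDerivAt_of_tendsto' (a := 0) (m := 0) (fun y _ => hder y)
    (hcont.integrable_of_hasCompactSupport hsupp).integrableOn
    (tendsto_const_nhds.congr' (by
      filter_upwards [eventually_ge_atTop (2 : ℝ)] with y hy
      rw [hFun_eq_zero_of_large hM hχ (by nlinarith), zero_div]))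
  have hz : hFun M χ (0 ^ 2) = 0 := hFun_eq_zero_of_small hM hχ (by
    simp)
  rw [hz] at hint
  have : ∫ y in Ioi (0 : ℝ), y ^ (Module.finrank ℝ (EuclideanSpace ℝ (Fin 4)) - 1) •
      (deriv (hFun M χ) (y ^ 2) / y ^ 2) = 0 := by
    refine Eq.trans ?_ (hint.trans (by simp))
    refine setIntegral_congr_fun measurableSet_Ioi fun y hy => ?_
    have hy : y ≠ 0 := ne_of_gt hy
    simp only [finrank_euclideanSpace, Fintype.card_fin, smul_eq_mul]
    field_simp
  rw [this]
  simp

end Limit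

/-! ### Riemann sums on the lattice -/

section Riemann

/-- The half-open cell of side `1 / L` with lower corner `p / L`. -/
def gridCell {ι : Type*} (L : ℝ) (p : ι → ℤ) : Set (ι → ℝ) :=
  Set.pi univ fun i => Ico ((p i : ℝ) / L) (((p i : ℝ) + 1) / L)

lemma mem_gridCell_iff {ι : Type*} {L : ℝ} (hL : 0 < L) {p : ι → ℤ} {y : ι → ℝ} :
    y ∈ gridCell L p ↔ p = fun i => ⌊L * y i⌋ := by
  rw [funext_iff, gridCell, mem_univ_pi]
  refine forall_congr' fun i => ?_
  rw [eq_comm, Int.floor_eq_iff, mem_Ico, div_le_iff₀ hL, lt_div_iff₀ hL, mul_comm L]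

variable {ι : Type*} [Fintype ι]

lemma measurableSet_gridCell (L : ℝ) (p : ι → ℤ) : MeasurableSet (gridCell L p) :=
  MeasurableSet.univ_pi fun _ => measurableSet_Ico

lemma volume_gridCell {L : ℝ} (p : ι → ℤ) :
    volume (gridCell L p) = ENNReal.ofReal L⁻¹ ^ Fintype.card ι := by
  rw [gridCell, Real.volume_pi_Ico]
  simp only [← sub_div, add_sub_cancel_left, one_div, Finset.prod_const, Finset.card_univ]

/-- First-order Riemann sum estimate for compactly supported Lipschitz functions. -/
lemma exists_riemann_sum_bound {φ : (ι → ℝ) → ℝ} {K : NNReal} (hφ : LipschitzWith K φ)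
    {R : ℝ} (hR : 0 ≤ R) (hsupp : ∀ x, R < ‖x‖ → φ x = 0) (C : ℝ) :
    ∃ C' : ℝ, ∀ L : ℝ, 1 ≤ L → ∀ (a : (ι → ℤ) → ℝ) (P : Finset (ι → ℤ)),
      (∀ p, |a p - φ fun i => (p i : ℝ) / L| ≤ C / L) →
      (∀ p ∉ P, a p = 0) → (∀ p : ι → ℤ, R * L < ‖p‖ → a p = 0) →
      |L⁻¹ ^ Fintype.card ι * ∑ p ∈ P, a p - ∫ x, φ x| ≤ C' / L := by
  -- `C / L` bounds the sampling error and `K / L` the variation of `φ` across a cell; the extra `1`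
  -- in the radius covers cells that protrude from the ball of radius `R`.
  refine ⟨(C + K) * volume.real (Metric.closedBall (0 : ι → ℝ) (R + 1)),
    fun L hL a P ha hP hRa => ?_⟩
  have hL0 : 0 < L := by linarith
  -- The Riemann sum is the integral of this step function, so only the two integrands need to be
  -- compared.
  set A : (ι → ℝ) → ℝ := fun y => ∑ p ∈ P, (gridCell L p).indicator (fun _ => a p) y with hA
  have hAeq : ∀ y, A y = a fun i => ⌊L * y i⌋ := by
    intro y
    simp only [hA]
    rw [Finset.sum_eq_single fun i => ⌊L * y i⌋]
    · exact indicator_of_mem ((mem_gridCell_iff hL0).2 rfl) _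
    · intro p _ hp
      exact indicator_of_notMem (fun h => hp ((mem_gridCell_iff hL0).1 h)) _
    · intro h
      rw [hP _ h]
      simp
  have hvol : ∀ p : ι → ℤ, volume.real (gridCell L p) = L⁻¹ ^ Fintype.card ι := by
    intro p
    rw [measureReal_def, volume_gridCell, ENNReal.toReal_pow, ENNReal.toReal_ofReal (by positivity)]
  have hint : ∀ p ∈ P, Integrable ((gridCell L p).indicator fun _ => a p) := by
    intro p _
    rw [integrable_indicator_iff (measurableSet_gridCell L p), integrableOn_const_iff]
    right
    rw [volume_gridCell]
    exact ENNReal.pow_lt_top ENNReal.ofReal_lt_top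
  have hAint : Integrable A := integrable_finsetSum P hint
  have hAval : ∫ y, A y = L⁻¹ ^ Fintype.card ι * ∑ p ∈ P, a p := by
    rw [hA, integral_finsetSum P hint, Finset.mul_sum]
    refine Finset.sum_congr rfl fun p _ => ?_
    rw [integral_indicator_const _ (measurableSet_gridCell L p), hvol, smul_eq_mul]
  have hφc : HasCompactSupport φ :=
    HasCompactSupport.intro (isCompact_closedBall (0 : ι → ℝ) R) fun x hx =>
      hsupp x (by simpa using hx)
  have hφint : Integrable φ := hφ.continuous.integrable_of_hasCompactSupport hφc
  rw [← hAval, ← integral_sub hAint hφint]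
  have hclose : ∀ y : ι → ℝ, ‖(fun i => ((⌊L * y i⌋ : ℤ) : ℝ) / L) - y‖ ≤ 1 / L := by
    intro y
    refine (pi_norm_le_iff_of_nonneg (by positivity)).2 fun i => ?_
    have h1 := Int.floor_le (L * y i)
    have h2 := Int.lt_floor_add_one (L * y i)
    have e : ((⌊L * y i⌋ : ℤ) : ℝ) / L - y i = (⌊L * y i⌋ - L * y i) / L := by field_simp
    rw [Pi.sub_apply, e, norm_div, Real.norm_of_nonneg hL0.le]
    gcongr
    rw [Real.norm_eq_abs, abs_le]
    constructor <;> linarith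
  have hbd : ∀ y ∈ Metric.closedBall (0 : ι → ℝ) (R + 1), ‖A y - φ y‖ ≤ (C + K) / L := by
    intro y _
    rw [hAeq]
    have h1 := ha fun i => ⌊L * y i⌋
    have h2 := hφ.dist_le_mul (fun i => ((⌊L * y i⌋ : ℤ) : ℝ) / L) y
    rw [dist_eq_norm, dist_eq_norm] at h2
    have h3 : (K : ℝ) * ‖(fun i => ((⌊L * y i⌋ : ℤ) : ℝ) / L) - y‖ ≤ K * (1 / L) := by
      gcongr
      exact hclose y
    calc ‖a (fun i => ⌊L * y i⌋) - φ y‖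
        ≤ ‖a (fun i => ⌊L * y i⌋) - φ (fun i => ((⌊L * y i⌋ : ℤ) : ℝ) / L)‖
          + ‖φ (fun i => ((⌊L * y i⌋ : ℤ) : ℝ) / L) - φ y‖ := norm_sub_le_norm_sub_add_norm_sub _ _ _
      _ ≤ C / L + K * (1 / L) := add_le_add h1 (h2.trans h3)
      _ = (C + K) / L := by ring
  have hzero : ∀ y ∉ Metric.closedBall (0 : ι → ℝ) (R + 1), A y - φ y = 0 := by
    intro y hy
    have hy : R + 1 < ‖y‖ := by simpa using hy
    rw [hAeq, hsupp y (by linarith), sub_zero]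
    refine hRa _ ?_
    by_contra hcon
    rw [not_lt] at hcon
    have h1 : ‖(fun i => ((⌊L * y i⌋ : ℤ) : ℝ) / L)‖ ≤ R := by
      refine (pi_norm_le_iff_of_nonneg hR).2 fun i => ?_
      rw [norm_div, Real.norm_of_nonneg hL0.le, div_le_iff₀ hL0]
      exact (norm_le_pi_norm (fun i => ⌊L * y i⌋) i).trans hcon
    have h2 := norm_sub_norm_le y fun i => ((⌊L * y i⌋ : ℤ) : ℝ) / L
    rw [norm_sub_rev] at h2
    have h3 : 1 / L ≤ 1 := by rw [div_le_one hL0]; exact hL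
    linarith [hclose y]
  rw [← setIntegral_eq_integral_of_forall_compl_eq_zero hzero, ← Real.norm_eq_abs]
  refine (norm_setIntegral_le_of_norm_le_const measure_closedBall_lt_top hbd).trans (le_of_eq ?_)
  ring

end Riemann

/-! ### Continuum limit of the sum over one momentum slice -/

section RiemannSlice

variable {M : ℕ} {χ : ℝ → ℝ}

/-- The scaling limit of the summands of the one-loop coefficient, as a function of `t = p²`. -/
def sliceProfile (M : ℕ) (χ : ℝ → ℝ) (θ : ℝ) (t : ℝ) : ℝ :=
  slicePoly M χ θ t / t ^ 2 + 2 * (deriv (hFun M χ) t / t ^ 1)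

lemma sliceProfile_contDiff (hM : 1 < M) (hχ : IsBump χ) (θ : ℝ) :
    ContDiff ℝ 1 (sliceProfile M χ θ) := by
  have hδ := inv_sq_pos hM
  have h1 : ContDiff ℝ 1 fun t => slicePoly M χ θ t / t ^ 2 :=
    contDiff_div_pow ((slicePoly_contDiff (M := M) hχ θ).of_le (by norm_cast))
      hδ (fun x hx => slicePoly_eq_zero θ (hFun_eq_zero_of_small hM hχ hx)) 2
  have h2 : ContDiff ℝ 1 fun t => deriv (hFun M χ) t / t ^ 1 :=
    contDiff_div_pow (deriv_hFun_contDiff hχ) (half_pos hδ)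
      (fun x hx => deriv_hFun_eq_zero_of_small hM hχ (by linarith)) 1
  exact h1.add (contDiff_const.mul h2)

lemma sliceProfile_eq_zero (hM : 1 < M) (hχ : IsBump χ) (θ : ℝ) {t : ℝ} (ht : 4 < t) :
    sliceProfile M χ θ t = 0 := by
  rw [sliceProfile, slicePoly_eq_zero θ (hFun_eq_zero_of_large hM hχ ht.le),
    deriv_hFun_eq_zero_of_large hM hχ ht]
  simp

lemma integrable_comp_norm_sq {Φ : ℝ → ℝ} (hΦ : Continuous Φ) {R : ℝ}
    (hR : ∀ t, R ≤ t → Φ t = 0) :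
    Integrable fun p : EuclideanSpace ℝ (Fin 4) => Φ (‖p‖ ^ 2) :=
  Continuous.integrable_of_hasCompactSupport (by fun_prop) (hasCompactSupport_comp_norm_sq hR)

/-- The `h'` half of the profile drops out by `integral_deriv_hFun`. The rest transports the
integral from coordinate space, where the Riemann sum lives, to Euclidean space. -/
lemma integral_sliceProfile (hM : 1 < M) (hχ : IsBump χ) (θ : ℝ) :
    ∫ x : Fin 4 → ℝ, sliceProfile M χ θ (∑ i, x i ^ 2) =
      ∫ p : EuclideanSpace ℝ (Fin 4), slicePoly M χ θ (‖p‖ ^ 2) / (‖p‖ ^ 2) ^ 2 := by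
  have hδ := inv_sq_pos hM
  rw [← (PiLp.volume_preserving_ofLp (Fin 4)).integral_comp
    (MeasurableEquiv.toLp 2 (Fin 4 → ℝ)).symm.measurableEmbedding]
  have h : ∀ p : EuclideanSpace ℝ (Fin 4), ∑ i, (WithLp.ofLp p) i ^ 2 = ‖p‖ ^ 2 := fun p =>
    (EuclideanSpace.real_norm_sq_eq p).symm
  simp only [h, sliceProfile]
  rw [integral_add, integral_const_mul]
  · simp only [pow_one]
    rw [integral_deriv_hFun hM hχ, mul_zero, add_zero]
  · have hc := contDiff_div_pow (slicePoly_contDiff (M := M) hχ θ) hδ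
      (fun x hx => slicePoly_eq_zero θ (hFun_eq_zero_of_small hM hχ hx)) 2
    refine integrable_comp_norm_sq (Φ := fun t => slicePoly M χ θ t / t ^ 2) hc.continuous (R := 4)
      fun t ht => ?_
    rw [slicePoly_eq_zero θ (hFun_eq_zero_of_large hM hχ ht), zero_div]
  · have hc := contDiff_div_pow (deriv_hFun_contDiff (M := M) hχ) (half_pos hδ)
      (fun x hx => deriv_hFun_eq_zero_of_small hM hχ (by linarith)) 1
    refine (integrable_comp_norm_sq (Φ := fun t => deriv (hFun M χ) t / t ^ 1) hc.continuous
      (R := 5) fun t ht => ?_).const_mul 2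
    rw [deriv_hFun_eq_zero_of_large hM hχ (by linarith), zero_div]

lemma exists_forall_abs_le_of_continuous {q : ℝ → ℝ} (hq : Continuous q) {R : ℝ}
    (hR : ∀ t, R < t → q t = 0) : ∃ C : ℝ, 0 ≤ C ∧ ∀ t, 0 ≤ t → |q t| ≤ C := by
  obtain ⟨C, hC⟩ := (isCompact_Icc (a := (0 : ℝ)) (b := R)).exists_bound_of_continuousOn
    hq.continuousOn
  refine ⟨max C 0, le_max_right _ _, fun t ht => ?_⟩
  rcases le_or_gt t R with h | h
  · exact (hC t ⟨ht, h⟩).trans (le_max_left _ _)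
  · rw [hR t h, abs_zero]
    exact le_max_right _ _

/-- This bound and the next remove the mass: after rescaling it is a shift `ε = m_r² / L²`, harmless
on a slice because there `t` stays above a fixed `δ`. -/
lemma abs_div_add_sub_div_le {q t δ ε C : ℝ} (hδ : 0 < δ) (ht : δ ≤ t) (hε : 0 ≤ ε)
    (hq : |q| ≤ C) : |q / (t + ε) - q / t| ≤ C * (ε / δ ^ 2) := by
  have ht0 : 0 < t := by linarith
  have : q / (t + ε) - q / t = -(q * (ε / (t * (t + ε)))) := by
    field_simp
    ring
  have hC : 0 ≤ C := (abs_nonneg q).trans hq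
  rw [this, abs_neg, abs_mul, abs_of_nonneg (a := ε / _) (by positivity)]
  gcongr
  nlinarith

lemma abs_div_sq_add_sub_div_sq_le {q t δ ε C : ℝ} (hδ : 0 < δ) (ht : δ ≤ t) (hε : 0 ≤ ε)
    (hq : |q| ≤ C) : |q / (t + ε) ^ 2 - q / t ^ 2| ≤ C * (2 * ε / δ ^ 3) := by
  have ht0 : 0 < t := by linarith
  have e : q / (t + ε) ^ 2 - q / t ^ 2 = -(q * (ε * (2 * t + ε) / (t ^ 2 * (t + ε) ^ 2))) := by
    field_simp
    ring
  rw [e, abs_neg, abs_mul, abs_of_nonneg (a := _ / _) (by positivity)]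
  have h1 : ε * (2 * t + ε) / (t ^ 2 * (t + ε) ^ 2) ≤ 2 * ε / (t ^ 2 * (t + ε)) := by
    rw [div_le_div_iff₀ (by positivity) (by positivity)]
    have : 0 ≤ t ^ 2 * (t + ε) * ε * ε := by positivity
    nlinarith
  have h2 : δ ^ 3 ≤ t ^ 2 * (t + ε) := by
    calc δ ^ 3 = δ ^ 2 * δ := by ring
      _ ≤ t ^ 2 * (t + ε) := by gcongr; linarith
  have hC : 0 ≤ C := (abs_nonneg q).trans hq
  refine mul_le_mul hq (h1.trans ?_) (by positivity) hC
  gcongr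

/-- The one-loop sum over one momentum slice, at scale `L`, approaches its continuum limit. -/
lemma exists_slice_sum_bound (hM : 1 < M) (hχ : IsBump χ) (mr θ : ℝ) :
    ∃ C : ℝ, ∀ L : ℝ, 1 ≤ L → ∀ P : Finset (Fin 4 → ℤ),
      (∀ p : Fin 4 → ℤ, momSq p ≤ 4 * L ^ 2 → p ∈ P) →
      |∑ p ∈ P, (slicePoly M χ θ (momSq p / L ^ 2) / (momSq p + mr ^ 2) ^ 2 +
          2 * (deriv (hFun M χ) (momSq p / L ^ 2) / L ^ 2 / (momSq p + mr ^ 2))) -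
        ∫ p : EuclideanSpace ℝ (Fin 4), slicePoly M χ θ (‖p‖ ^ 2) / (‖p‖ ^ 2) ^ 2| ≤ C / L := by
  have hδ := inv_sq_pos hM
  set δ : ℝ := ((M : ℝ) ^ 2)⁻¹
  obtain ⟨C₁, hC₁, h1⟩ := exists_forall_abs_le_of_continuous
    (slicePoly_contDiff (M := M) hχ θ).continuous (R := 4)
    (fun t ht => slicePoly_eq_zero θ (hFun_eq_zero_of_large hM hχ ht.le))
  obtain ⟨C₂, hC₂, h2⟩ := exists_forall_abs_le_of_continuous
    (deriv_hFun_contDiff (M := M) hχ).continuous (R := 4)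
    (fun t ht => deriv_hFun_eq_zero_of_large hM hχ ht)
  have hΦ : ContDiff ℝ 1 fun x : Fin 4 → ℝ => sliceProfile M χ θ (∑ i, x i ^ 2) :=
    (sliceProfile_contDiff hM hχ θ).comp
      (ContDiff.sum fun i _ => (contDiff_apply ℝ ℝ i).pow 2)
  have hsq : ∀ {ι : Type} [Fintype ι] (x : ι → ℝ), ‖x‖ ^ 2 ≤ ∑ i, x i ^ 2 := by
    intro ι _ x
    have : ‖x‖ ≤ √(∑ i, x i ^ 2) := by
      refine (pi_norm_le_iff_of_nonneg (Real.sqrt_nonneg _)).2 fun i => ?_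
      rw [Real.norm_eq_abs, ← Real.sqrt_sq_eq_abs]
      exact Real.sqrt_le_sqrt (Finset.single_le_sum (f := fun i => x i ^ 2)
        (fun i _ => sq_nonneg _) (Finset.mem_univ i))
    calc ‖x‖ ^ 2 ≤ √(∑ i, x i ^ 2) ^ 2 := by gcongr
      _ = _ := Real.sq_sqrt (Finset.sum_nonneg fun i _ => sq_nonneg _)
  have hz : ∀ x : Fin 4 → ℝ, 2 < ‖x‖ → sliceProfile M χ θ (∑ i, x i ^ 2) = 0 := fun x hx =>
    sliceProfile_eq_zero hM hχ θ (lt_of_lt_of_le (by nlinarith) (hsq x))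
  obtain ⟨K, hK⟩ : ∃ K, LipschitzWith K fun x : Fin 4 → ℝ => sliceProfile M χ θ (∑ i, x i ^ 2) :=
    ContDiff.lipschitzWith_of_hasCompactSupport
      (HasCompactSupport.intro (isCompact_closedBall (0 : Fin 4 → ℝ) 2) fun x hx =>
        hz x (by simpa using hx)) hΦ one_ne_zero
  obtain ⟨C', hC'⟩ := exists_riemann_sum_bound hK zero_le_two hz
    (C₁ * (2 * mr ^ 2 / δ ^ 3) + 2 * (C₂ * (mr ^ 2 / δ ^ 2)))
  refine ⟨C', fun L hL P hP => ?_⟩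
  have hL0 : 0 < L := by linarith
  have hbig : ∀ p : Fin 4 → ℤ, 4 * L ^ 2 < momSq p →
      slicePoly M χ θ (momSq p / L ^ 2) / (momSq p / L ^ 2 + mr ^ 2 / L ^ 2) ^ 2 +
      2 * (deriv (hFun M χ) (momSq p / L ^ 2) / (momSq p / L ^ 2 + mr ^ 2 / L ^ 2)) = 0 := by
    intro p hp
    have : 4 < momSq p / L ^ 2 := by rwa [lt_div_iff₀ (by positivity)]
    rw [slicePoly_eq_zero θ (hFun_eq_zero_of_large hM hχ this.le),
      deriv_hFun_eq_zero_of_large hM hχ this]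
    simp
  have key := hC' L hL (fun p =>
    slicePoly M χ θ (momSq p / L ^ 2) / (momSq p / L ^ 2 + mr ^ 2 / L ^ 2) ^ 2 +
      2 * (deriv (hFun M χ) (momSq p / L ^ 2) / (momSq p / L ^ 2 + mr ^ 2 / L ^ 2))) P
    (fun p => ?_) (fun p hp => hbig p ?_) (fun p hp => hbig p ?_)
  · rw [integral_sliceProfile hM hχ] at key
    refine le_trans (le_of_eq ?_) key
    congr 2
    rw [Finset.mul_sum]
    refine Finset.sum_congr rfl fun p _ => ?_
    -- Both terms scale as `L⁻⁴`, which is exactly the volume of a grid cell in four dimensions.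
    rw [← add_div, Fintype.card_fin]
    field_simp
  · have hs : ∑ i, ((p i : ℝ) / L) ^ 2 = momSq p / L ^ 2 := by
      simp only [momSq, div_pow, Finset.sum_div]
    rw [hs, sliceProfile]
    set t := momSq p / L ^ 2
    have ht0 : 0 ≤ t := by
      have : 0 ≤ momSq p := Finset.sum_nonneg fun i _ => sq_nonneg _
      positivity
    have hε : mr ^ 2 / L ^ 2 ≤ mr ^ 2 / L := by
      gcongr
      nlinarith
    -- Below `δ` the slice and its derivative vanish, so there is nothing to compare; above it the
    -- denominators are bounded away from zero.
    rcases lt_or_ge t δ with ht | ht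
    · have ht' : |t| < δ := by rwa [abs_of_nonneg ht0]
      rw [slicePoly_eq_zero θ (hFun_eq_zero_of_small hM hχ ht'.le),
        deriv_hFun_eq_zero_of_small hM hχ ht']
      simp
      positivity
    · have a1 := abs_div_sq_add_sub_div_sq_le hδ ht (ε := mr ^ 2 / L ^ 2) (by positivity) (h1 t ht0)
      have a2 := abs_div_add_sub_div_le hδ ht (ε := mr ^ 2 / L ^ 2) (by positivity) (h2 t ht0)
      have b1 : C₁ * (2 * (mr ^ 2 / L ^ 2) / δ ^ 3) ≤ C₁ * (2 * mr ^ 2 / δ ^ 3) / L := by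
        calc C₁ * (2 * (mr ^ 2 / L ^ 2) / δ ^ 3) ≤ C₁ * (2 * (mr ^ 2 / L) / δ ^ 3) := by gcongr
          _ = _ := by ring
      have b2 : C₂ * (mr ^ 2 / L ^ 2 / δ ^ 2) ≤ C₂ * (mr ^ 2 / δ ^ 2) / L := by
        calc C₂ * (mr ^ 2 / L ^ 2 / δ ^ 2) ≤ C₂ * (mr ^ 2 / L / δ ^ 2) := by gcongr
          _ = _ := by ring
      rw [pow_one]
      rw [abs_le] at a1 a2 ⊢
      rw [add_div _ _ L, mul_div_assoc 2 _ L]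
      constructor <;> linarith [a1.1, a1.2, a2.1, a2.2]
  · by_contra h
    exact hp (hP p (not_lt.1 h))
  · have h3 := hsq fun i => (p i : ℝ)
    have h4 : ‖fun i => (p i : ℝ)‖ = ‖p‖ := by
      simp only [Pi.norm_def]
      rfl
    rw [h4] at h3
    refine lt_of_lt_of_le ?_ h3
    nlinarith

end RiemannSlice

/-! ### The one-loop coefficients -/

section Coefficients

lemma momSq_nonneg (p : Fin 4 → ℤ) : 0 ≤ momSq p := Finset.sum_nonneg fun _ _ => sq_nonneg _

lemma sq_le_momSq (p : Fin 4 → ℤ) (i : Fin 4) : (p i : ℝ) ^ 2 ≤ momSq p :=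
  Finset.single_le_sum (f := fun i => (p i : ℝ) ^ 2) (fun _ _ => sq_nonneg _) (Finset.mem_univ i)

/-- The momenta of sup norm at most `2 M ^ jmax`: all those that survive the cutoff. -/
def latticeBox (M jmax : ℕ) : Finset (Fin 4 → ℤ) :=
  Fintype.piFinset fun _ => Finset.Icc (-(2 * (M : ℤ) ^ jmax)) (2 * (M : ℤ) ^ jmax)

variable {M : ℕ} {χ : ℝ → ℝ}

lemma mem_latticeBox_iff {jmax : ℕ} {p : Fin 4 → ℤ} :
    p ∈ latticeBox M jmax ↔ ∀ i, (p i : ℝ) ^ 2 ≤ (2 * (M : ℝ) ^ jmax) ^ 2 := by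
  rw [latticeBox, Fintype.mem_piFinset]
  refine forall_congr' fun i => ?_
  rw [Finset.mem_Icc, ← abs_le, sq_le_sq, abs_of_nonneg (a := 2 * (M : ℝ) ^ jmax) (by positivity)]
  norm_cast

lemma mem_latticeBox {jmax : ℕ} {p : Fin 4 → ℤ} (hp : momSq p ≤ 4 * ((M : ℝ) ^ jmax) ^ 2) :
    p ∈ latticeBox M jmax := by
  refine mem_latticeBox_iff.2 fun i => (sq_le_momSq p i).trans (hp.trans (le_of_eq ?_))
  ring

lemma latticeBox_mono (hM : 1 < M) {k l : ℕ} (h : k ≤ l) : latticeBox M k ⊆ latticeBox M l := by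
  intro p hp
  rw [mem_latticeBox_iff] at hp ⊢
  refine fun i => (hp i).trans ?_
  have : (1 : ℝ) ≤ M := by exact_mod_cast hM.le
  gcongr

lemma kappaAt_natCast (k : ℕ) (x : ℝ) : kappaAt M χ k x = kappa χ (x / ((M : ℝ) ^ k) ^ 2) := by
  rw [kappaAt]
  congr 1
  rw [mul_comm, div_eq_mul_inv, neg_mul, zpow_neg]
  norm_cast
  rw [← pow_mul, mul_comm k]

lemma kappaAt_eq_zero (hM : 1 < M) (hχ : IsBump χ) {k : ℕ} {x : ℝ}
    (hx : 4 * ((M : ℝ) ^ k) ^ 2 ≤ x) : kappaAt M χ k x = 0 := by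
  have : (0 : ℝ) < M := by exact_mod_cast hM.le
  rw [kappaAt_natCast, kappa_eq_zero hχ]
  rwa [le_div_iff₀ (by positivity)]

lemma kappaAt_eq_one (hM : 1 < M) (hχ : IsBump χ) {k : ℕ} {x : ℝ} (h0 : 0 ≤ x)
    (hx : x ≤ ((M : ℝ) ^ k) ^ 2) : kappaAt M χ k x = 1 := by
  have : (0 : ℝ) < M := by exact_mod_cast hM.le
  rw [kappaAt_natCast, kappa_eq_one hχ]
  rw [abs_of_nonneg (by positivity)]
  exact div_le_one_of_le₀ hx (by positivity)

lemma kappaAt_nonneg (hχ : IsBump χ) (j : ℤ) (x : ℝ) : 0 ≤ kappaAt M χ j x := kappa_nonneg hχ _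

lemma kappaAt_le_one (hχ : IsBump χ) (j : ℤ) (x : ℝ) : kappaAt M χ j x ≤ 1 := kappa_le_one hχ _

lemma eta_succ_eq (hM : 1 < M) (n : ℕ) (x : ℝ) :
    eta M χ (n + 1) x = hFun M χ (x / ((M : ℝ) ^ (n + 1)) ^ 2) := by
  have : (0 : ℝ) < M := by exact_mod_cast hM.le
  rw [eta, if_neg (by omega), add_sub_cancel_right, hFun]
  have h := kappaAt_natCast (M := M) (χ := χ) (n + 1) x
  push_cast at h
  rw [h, kappaAt_natCast]
  congr 2
  field_simp
  ring

lemma deriv_eta_succ (hM : 1 < M) (n : ℕ) (x : ℝ) :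
    deriv (eta M χ (n + 1)) x =
      deriv (hFun M χ) (x / ((M : ℝ) ^ (n + 1)) ^ 2) / ((M : ℝ) ^ (n + 1)) ^ 2 := by
  have h : eta M χ (n + 1) = fun x => hFun M χ ((((M : ℝ) ^ (n + 1)) ^ 2)⁻¹ * x) := by
    ext x
    rw [eta_succ_eq hM, div_eq_inv_mul]
  rw [h, deriv_comp_mul_left, smul_eq_mul, ← div_eq_inv_mul, ← div_eq_inv_mul]

/-- On the support of slice `n + 1` both `κ_{n+2}` and `κ_{jmax}` equal `1`, so slices beyond `n +
2` contribute nothing: only neighbouring slices overlap. -/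
lemma hFun_mul_etaGe (hM : 1 < M) (hχ : IsBump χ) {jmax n : ℕ} (hn : n + 2 ≤ jmax) {x : ℝ}
    (hx : 0 ≤ x) :
    hFun M χ (x / ((M : ℝ) ^ (n + 1)) ^ 2) * etaGe M χ jmax (n + 2) x =
      hFun M χ (x / ((M : ℝ) ^ (n + 1)) ^ 2) *
        hFun M χ ((M : ℝ) ^ (-2 : ℤ) * (x / ((M : ℝ) ^ (n + 1)) ^ 2)) := by
  have hM0 : (0 : ℝ) < M := by exact_mod_cast hM.le
  have hM1 : (1 : ℝ) ≤ M := by exact_mod_cast hM.le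
  rcases le_or_gt 4 (x / ((M : ℝ) ^ (n + 1)) ^ 2) with h | h
  · rw [hFun_eq_zero_of_large hM hχ h, zero_mul, zero_mul]
  · rw [div_lt_iff₀ (by positivity)] at h
    have h2 : x ≤ ((M : ℝ) ^ (n + 2)) ^ 2 := by
      refine h.le.trans ?_
      rw [pow_succ (M : ℝ) (n + 1), mul_pow, mul_comm]
      gcongr
      exact four_le_sq hM
    have e1 := etaGe_succ (M := M) (χ := χ) (jmax := jmax) (n + 1) (by omega) x
    have e2 := eta_succ_eq (χ := χ) hM (n + 1) x
    have e3 : (M : ℝ) ^ (-2 : ℤ) * (x / ((M : ℝ) ^ (n + 1)) ^ 2) =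
        x / ((M : ℝ) ^ (n + 1 + 1)) ^ 2 := by
      rw [zpow_neg, zpow_ofNat]
      field_simp
      ring
    rw [e3, ← e2, eta, if_neg (by omega)]
    push_cast at e1 ⊢
    rw [add_sub_cancel_right, show (n : ℤ) + 2 = n + 1 + 1 by ring, e1,
      kappaAt_eq_one hM hχ hx (h2.trans (by gcongr))]
    have e4 := kappaAt_eq_one hM hχ (k := n + 2) hx h2
    push_cast at e4
    rw [show (n : ℤ) + 1 + 1 = n + 2 by ring, e4]

/-- The coefficient of `g_b²` in the effective coupling `g_j`. -/
def oneLoop (M : ℕ) (χ : ℝ → ℝ) (jmax : ℕ) (mr : ℝ) (j : ℤ) : ℝ :=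
  ∑ p ∈ latticeBox M jmax,
    (2 * (etaGe M χ jmax (j + 1) (momSq p) / (momSq p + mr ^ 2) ^ 2 -
        deriv (etaGe M χ jmax (j + 1)) (momSq p) / (momSq p + mr ^ 2)) -
      etaGe M χ jmax (j + 1) (momSq p) ^ 2 / (momSq p + mr ^ 2) ^ 2)

/-- The one-loop coefficient of the discrete flow of the effective coupling. -/
def betaCoeff (M : ℕ) (χ : ℝ → ℝ) (mr : ℝ) (jmax : ℕ) (j : ℤ) : ℝ :=
  oneLoop M χ jmax mr (j + 1) - oneLoop M χ jmax mr j

/-- Splitting off the lowest slice of `η_{≥ j+1}`, all terms in `η_{≥ j+2}` alone cancel between the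
two scales; the square leaves the cross term. -/
lemma betaCoeff_eq (hχ : IsBump χ) (mr : ℝ) {jmax : ℕ} {j : ℤ} (hj : j + 1 ≤ jmax) :
    betaCoeff M χ mr jmax j = ∑ p ∈ latticeBox M jmax,
      ((eta M χ (j + 1) (momSq p) ^ 2 +
          2 * (eta M χ (j + 1) (momSq p) * etaGe M χ jmax (j + 2) (momSq p)) -
          2 * eta M χ (j + 1) (momSq p)) / (momSq p + mr ^ 2) ^ 2 +
        2 * (deriv (eta M χ (j + 1)) (momSq p) / (momSq p + mr ^ 2))) := by
  rw [betaCoeff, oneLoop, oneLoop, ← Finset.sum_sub_distrib]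
  refine Finset.sum_congr rfl fun p _ => ?_
  have h1 : etaGe M χ jmax (j + 1) =
      fun x => eta M χ (j + 1) x + etaGe M χ jmax (j + 2) x := by
    ext x
    rw [etaGe_eq_add hj, add_assoc j 1 1]
    rfl
  have h2 : deriv (etaGe M χ jmax (j + 1)) (momSq p) =
      deriv (eta M χ (j + 1)) (momSq p) + deriv (etaGe M χ jmax (j + 2)) (momSq p) := by
    rw [h1]
    exact deriv_fun_add ((eta_contDiff hχ _).differentiable (by simp) _)
      ((etaGe_contDiff hχ _ _).differentiable (by simp) _)
  rw [h2, etaGe_eq_add hj, add_assoc j 1 1, show (1 : ℤ) + 1 = 2 by norm_num]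
  ring

/-- The overlap hypothesis treats both regimes at once: `θ = 1` when a next slice exists, `θ = 0` at
the last step. The scale is `L = M ^ (n + 1)`, so one factor of `M` is given away. -/
lemma exists_betaCoeff_bound (hM : 1 < M) (hχ : IsBump χ) (mr θ : ℝ) :
    ∃ C : ℝ, 0 ≤ C ∧ ∀ jmax n : ℕ, n + 1 ≤ jmax →
      (∀ x, 0 ≤ x → hFun M χ (x / ((M : ℝ) ^ (n + 1)) ^ 2) * etaGe M χ jmax (n + 2) x =
      θ * hFun M χ (x / ((M : ℝ) ^ (n + 1)) ^ 2) *
        hFun M χ ((M : ℝ) ^ (-2 : ℤ) * (x / ((M : ℝ) ^ (n + 1)) ^ 2))) →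
      |betaCoeff M χ mr jmax n -
        ∫ p : EuclideanSpace ℝ (Fin 4), slicePoly M χ θ (‖p‖ ^ 2) / (‖p‖ ^ 2) ^ 2| ≤
      C * (M : ℝ) ^ (-(n : ℤ)) := by
  obtain ⟨C, hC⟩ := exists_slice_sum_bound hM hχ mr θ
  have hM0 : (0 : ℝ) < M := by exact_mod_cast hM.le
  have hM1 : (1 : ℝ) ≤ M := by exact_mod_cast hM.le
  refine ⟨|C|, abs_nonneg C, fun jmax n hn h => ?_⟩
  have := hC ((M : ℝ) ^ (n + 1)) (one_le_pow₀ hM1) (latticeBox M jmax)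
    fun p hp => latticeBox_mono hM hn (mem_latticeBox hp)
  rw [betaCoeff_eq hχ mr (by omega)]
  refine le_trans (le_of_eq ?_) (this.trans ?_)
  · congr 2
    refine Finset.sum_congr rfl fun p _ => ?_
    rw [deriv_eta_succ hM, eta_succ_eq hM, h _ (momSq_nonneg p), slicePoly]
    ring
  · rw [zpow_neg, zpow_natCast, ← div_eq_mul_inv]
    refine (div_le_div_of_nonneg_right (le_abs_self C) (by positivity)).trans ?_
    gcongr
    exact n.le_succ

/-- The slice `η_0 = κ_0` contains the low momenta and is not a rescaled `h`, so no limit is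
available. Since `M ^ (-j)` is just `M` at `j = -1`, a bound uniform in `jmax` suffices. -/
lemma exists_betaCoeff_neg_one_bound (hM : 1 < M) (hχ : IsBump χ) (mr : ℝ) :
    ∃ C : ℝ, ∀ jmax : ℕ, |betaCoeff M χ mr jmax (-1)| ≤ C := by
  -- All cutoffs lie in `[0, 1]`, and `5 = 1 + 2 + 2` crudely bounds the three terms of the
  -- numerator.
  refine ⟨∑ p ∈ latticeBox M 0, (5 / (momSq p + mr ^ 2) ^ 2 +
    2 * (|deriv (kappaAt M χ 0) (momSq p)| / (momSq p + mr ^ 2))), fun jmax => ?_⟩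
  rw [betaCoeff_eq hχ mr (by omega)]
  have he : eta M χ (-1 + 1) = kappaAt M χ 0 := by
    ext x
    rw [eta, if_pos (by norm_num)]
  rw [he, ← Finset.sum_subset (latticeBox_mono hM (Nat.zero_le jmax))]
  · refine (Finset.abs_sum_le_sum_abs _ _).trans (Finset.sum_le_sum fun p _ => ?_)
    have hp := momSq_nonneg p
    refine (abs_add_le _ _).trans (add_le_add ?_ ?_)
    · rw [abs_div, abs_of_nonneg (a := (momSq p + mr ^ 2) ^ 2) (by positivity)]
      gcongr
      have e := etaGe_succ (M := M) (χ := χ) (jmax := jmax) 0 (by omega) (momSq p)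
      simp only [CharP.cast_eq_zero, zero_add] at e
      rw [show (-1 : ℤ) + 2 = 1 by norm_num, e]
      have h1 := kappaAt_nonneg (M := M) hχ 0 (momSq p)
      have h2 := kappaAt_le_one (M := M) hχ 0 (momSq p)
      have h3 := kappaAt_nonneg (M := M) hχ jmax (momSq p)
      have h4 := kappaAt_le_one (M := M) hχ jmax (momSq p)
      rw [abs_le]
      constructor <;> nlinarith
    · rw [abs_mul, abs_div, abs_of_nonneg (a := (2 : ℝ)) (by norm_num),
        abs_of_nonneg (a := (momSq p + mr ^ 2)) (by positivity)]
  · intro p _ hp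
    have hp : 4 < momSq p := by
      by_contra h
      exact hp (mem_latticeBox (by simpa using h))
    have hz : ∀ x : ℝ, 4 ≤ x → kappaAt M χ 0 x = 0 := fun x hx =>
      kappaAt_eq_zero (k := 0) hM hχ (by simpa using hx)
    have hd : deriv (kappaAt M χ 0) (momSq p) = 0 := by
      have : kappaAt M χ 0 =ᶠ[𝓝 (momSq p)] fun _ => 0 := by
        filter_upwards [lt_mem_nhds hp] with y hy using hz y hy.le
      rw [this.deriv_eq, deriv_const]
    rw [hz _ hp.le, hd]
    simp

lemma exists_betaCoeff_bounds (hM : 1 < M) (hχ : IsBump χ) (mr : ℝ) :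
    ∃ K : ℝ,
      (∀ (jmax : ℕ) (j : ℤ), -1 ≤ j → j ≤ (jmax : ℤ) - 2 →
        |betaCoeff M χ mr jmax j - betaTwo M χ| ≤ K * (M : ℝ) ^ (-j)) ∧
      (∀ jmax : ℕ, |betaCoeff M χ mr jmax ((jmax : ℤ) - 1) - betaTwoUV M χ| ≤
        K * (M : ℝ) ^ (-((jmax : ℤ) - 1))) := by
  obtain ⟨C₁, hC₁, h1⟩ := exists_betaCoeff_bound hM hχ mr 1
  obtain ⟨C₀, hC₀, h0⟩ := exists_betaCoeff_bound hM hχ mr 0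
  obtain ⟨C, hC⟩ := exists_betaCoeff_neg_one_bound hM hχ mr
  rw [betaTwo_eq, betaTwoUV_eq]
  set b := ∫ p : EuclideanSpace ℝ (Fin 4), slicePoly M χ 1 (‖p‖ ^ 2) / (‖p‖ ^ 2) ^ 2
  set b' := ∫ p : EuclideanSpace ℝ (Fin 4), slicePoly M χ 0 (‖p‖ ^ 2) / (‖p‖ ^ 2) ^ 2
  have hM1 : (1 : ℝ) ≤ M := by exact_mod_cast hM.le
  have hCnn : 0 ≤ C := (abs_nonneg _).trans (hC 0)
  have hneg : ∀ (jmax : ℕ) (c : ℝ), |betaCoeff M χ mr jmax (-1) - c| ≤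
      (C + |c|) * (M : ℝ) ^ (-(-1 : ℤ)) := by
    intro jmax c
    refine (abs_sub _ _).trans ((add_le_add_left (hC jmax) _).trans ?_)
    rw [neg_neg, zpow_one]
    nlinarith [abs_nonneg c]
  refine ⟨C₁ + C₀ + (C + |b|) + (C + |b'|), fun jmax j hj hj' => ?_, fun jmax => ?_⟩
  · rcases eq_or_lt_of_le hj with rfl | hj
    · refine (hneg jmax b).trans ?_
      refine mul_le_mul_of_nonneg_right ?_ (by positivity)
      linarith [abs_nonneg b']
    · obtain ⟨n, rfl⟩ := Int.eq_ofNat_of_zero_le (show 0 ≤ j by omega)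
      refine (h1 jmax n (by omega) fun x hx => ?_).trans ?_
      · rw [one_mul, hFun_mul_etaGe hM hχ (by omega) hx]
      · refine mul_le_mul_of_nonneg_right ?_ (by positivity)
        linarith [abs_nonneg b', abs_nonneg b]
  -- For `jmax = 0` the last step is `j = -1`, where only boundedness is used.
  · rcases jmax with _ | n
    · have := hneg 0 b'
      simp only [CharP.cast_eq_zero, zero_sub] at this ⊢
      refine this.trans ?_
      refine mul_le_mul_of_nonneg_right ?_ (by positivity)
      linarith [abs_nonneg b]
    · have := h0 (n + 1) n le_rfl fun x _ => by
        rw [etaGe_of_lt (by push_cast; omega)]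
        ring
      push_cast
      rw [add_sub_cancel_right]
      refine this.trans ?_
      refine mul_le_mul_of_nonneg_right ?_ (by positivity)
      linarith [abs_nonneg b', abs_nonneg b]

end Coefficients

/-! ### Existence of melonic families -/

section Existence

open scoped ContDiff

/-- Analytic perturbation of the identity: `x = x₀ + g U(x)` has an analytic solution near
`g = 0`. -/
lemma exists_analyticAt_fixed_point {E : Type*} [NormedAddCommGroup E] [NormedSpace ℂ E]
    [CompleteSpace E] {U : E → E} {x₀ : E} (hU : ContDiffAt ℂ ω U x₀) :
    ∃ x : ℂ → E, AnalyticAt ℂ x 0 ∧ x 0 = x₀ ∧ ∀ᶠ g in 𝓝 (0 : ℂ), x g = x₀ + g • U (x g) := by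
  set f : ℂ × E → E := fun v => v.2 - v.1 • U v.2 with hf_def
  have hf : ContDiffAt ℂ ω f ((0 : ℂ), x₀) := by
    have : ContDiffAt ℂ ω (fun v : ℂ × E => U v.2) ((0 : ℂ), x₀) :=
      ContDiffAt.comp ((0 : ℂ), x₀) hU contDiffAt_snd
    exact contDiffAt_snd.sub (contDiffAt_fst.smul this)
  have hinv : fderiv ℂ f (0, x₀) ∘L .inr ℂ ℂ E = ContinuousLinearMap.id ℂ E := by
    have h1 := (hf.differentiableAt (by simp)).hasFDerivAt.comp x₀ (hasFDerivAt_prodMk_right 0 x₀)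
    have h2 : f ∘ (fun x => ((0 : ℂ), x)) = id := by
      ext x
      simp [hf_def]
    rw [h2] at h1
    exact h1.unique (hasFDerivAt_id x₀)
  have if₂ : (fderiv ℂ f (0, x₀) ∘L .inr ℂ ℂ E).IsInvertible := by
    rw [hinv]
    exact ⟨ContinuousLinearEquiv.refl ℂ E, rfl⟩
  refine ⟨hf.implicitFunction (by simp) if₂, ?_, hf.implicitFunction_apply_self (by simp) if₂, ?_⟩
  · exact (hf.contDiffAt_implicitFunction (by simp) if₂).analyticAt
  · filter_upwards [hf.eventually_apply_implicitFunction (by simp) if₂] with g hg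
    simp only [hf_def, zero_smul, sub_zero] at hg
    exact sub_eq_iff_eq_add.1 hg

/-- A function solving `σ = -lam ∑ k / D` with `D` affine in `σ` is differentiable at zero. -/
lemma hasDerivWithinAt_of_fixed_point {α : Type*} (P : Finset α) {k D : α → ℝ → ℂ} {k' : α → ℂ}
    {Z lam : ℂ} {σ : ℝ → ℂ}
    (hk : ∀ p ∈ P, HasDerivWithinAt (k p) (k' p) (Ici 0) 0)
    (hσ : ContinuousWithinAt σ (Ici 0) 0)
    (hD : ∀ p ∈ P, ∀ s, D p s = D p 0 + Z * (s : ℂ) - (σ s - σ 0))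
    (hD0 : ∀ p ∈ P, D p 0 ≠ 0)
    (hfix : ∀ᶠ s in 𝓝[≥] (0 : ℝ), σ s = -lam * ∑ p ∈ P, k p s / D p s)
    (hA : 1 + lam * ∑ p ∈ P, k p 0 / D p 0 ^ 2 ≠ 0)
    (hZ : Z - 1 = -lam * ∑ p ∈ P, (k' p / D p 0 - k p 0 / D p 0 ^ 2)) :
    HasDerivWithinAt σ (Z - 1) (Ici 0) 0 := by
  have hDlim : ∀ p ∈ P, Tendsto (D p) (𝓝[>] 0) (𝓝 (D p 0)) := by
    intro p hp
    have h1 : Tendsto (fun s : ℝ => D p 0 + Z * (s : ℂ) - (σ s - σ 0)) (𝓝[>] 0)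
        (𝓝 (D p 0 + Z * ((0 : ℝ) : ℂ) - (σ 0 - σ 0))) := by
      refine Tendsto.sub ?_ ((hσ.mono_left (nhdsWithin_mono _ Ioi_subset_Ici_self)).sub_const _)
      exact ((by fun_prop : Continuous fun s : ℝ => D p 0 + Z * (s : ℂ)).tendsto 0).mono_left
        nhdsWithin_le_nhds
    simp only [Complex.ofReal_zero, mul_zero, add_zero, sub_self, sub_zero] at h1
    exact h1.congr fun s => (hD p hp s).symm
  -- Because `D` is affine in `σ`, the difference quotient of `σ` solves a linear equation,
  -- coefficient times slope equals `R(s)`. This is the limit of the coefficient, nonzero by `hA`,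
  -- so the slope converges without assuming differentiability.
  have hA' : Tendsto (fun s : ℝ => 1 + lam * ∑ p ∈ P, k p 0 / (D p s * D p 0)) (𝓝[>] 0)
      (𝓝 (1 + lam * ∑ p ∈ P, k p 0 / D p 0 ^ 2)) := by
    refine tendsto_const_nhds.add (tendsto_const_nhds.mul (tendsto_finsetSum _ fun p hp => ?_))
    rw [sq]
    exact tendsto_const_nhds.div ((hDlim p hp).mul tendsto_const_nhds)
      (mul_ne_zero (hD0 p hp) (hD0 p hp))
  have hR : Tendsto (fun s : ℝ => -lam * ∑ p ∈ P,
      (slope (k p) 0 s / D p s - k p 0 * Z / (D p s * D p 0))) (𝓝[>] 0)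
      (𝓝 (-lam * ∑ p ∈ P, (k' p / D p 0 - k p 0 * Z / D p 0 ^ 2))) := by
    refine tendsto_const_nhds.mul (tendsto_finsetSum _ fun p hp => Tendsto.sub ?_ ?_)
    · have := hasDerivWithinAt_iff_tendsto_slope.1 (hk p hp)
      rw [Ici_sdiff_left] at this
      exact this.div (hDlim p hp) (hD0 p hp)
    · rw [sq]
      exact tendsto_const_nhds.div ((hDlim p hp).mul tendsto_const_nhds)
        (mul_ne_zero (hD0 p hp) (hD0 p hp))
  rw [hasDerivWithinAt_iff_tendsto_slope, Ici_sdiff_left]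
  -- `hZ` is the differentiated equation written with `D'(0) = 1`, that is, with the slope presumed
  -- to be `Z - 1`; it identifies the limit just found with that value.
  have hval : (-lam * ∑ p ∈ P, (k' p / D p 0 - k p 0 * Z / D p 0 ^ 2)) /
      (1 + lam * ∑ p ∈ P, k p 0 / D p 0 ^ 2) = Z - 1 := by
    rw [div_eq_iff hA, mul_add, mul_one]
    have e : ∑ p ∈ P, (k' p / D p 0 - k p 0 * Z / D p 0 ^ 2) =
        ∑ p ∈ P, (k' p / D p 0 - k p 0 / D p 0 ^ 2) -
          (Z - 1) * ∑ p ∈ P, k p 0 / D p 0 ^ 2 := by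
      rw [Finset.mul_sum, ← Finset.sum_sub_distrib]
      exact Finset.sum_congr rfl fun p _ => by ring
    rw [e]
    linear_combination -hZ
  rw [← hval]
  refine (hR.div hA' hA).congr' ?_
  have hne : ∀ᶠ s in 𝓝[>] (0 : ℝ), ∀ p ∈ P, D p s ≠ 0 :=
    (eventually_all_finset P).2 fun p hp => (hDlim p hp).eventually_ne (hD0 p hp)
  filter_upwards [hne, hA'.eventually_ne hA, self_mem_nhdsWithin,
    hfix.filter_mono (nhdsWithin_mono _ Ioi_subset_Ici_self)] with s hs hAs hspos hsfix
  have hs0 : (s : ℂ) ≠ 0 := by exact_mod_cast (ne_of_gt hspos)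
  have h0fix : σ 0 = -lam * ∑ p ∈ P, k p 0 / D p 0 := hfix.self_of_nhdsWithin self_mem_Ici
  rw [Pi.div_apply, div_eq_iff hAs]
  have hslope : ∀ f : ℝ → ℂ, slope f 0 s = (f s - f 0) / s := fun f => by
    rw [slope_def_module, sub_zero, div_eq_inv_mul, Complex.real_smul]
    push_cast
    rfl
  simp only [hslope]
  rw [div_mul_eq_mul_div, eq_div_iff hs0]
  have key : ∀ p ∈ P, k p s / D p s - k p 0 / D p 0 =
      s * (((k p s - k p 0) / s) / D p s - k p 0 * Z / (D p s * D p 0)) +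
        (σ s - σ 0) * (k p 0 / (D p s * D p 0)) := by
    intro p hp
    have h1 := hs p hp
    have h2 := hD0 p hp
    have h3 := hD p hp s
    field_simp
    rw [h3]
    ring
  have hd : σ s - σ 0 = -lam * ∑ p ∈ P, (k p s / D p s - k p 0 / D p 0) := by
    rw [hsfix, h0fix, Finset.sum_sub_distrib]
    ring
  rw [Finset.sum_congr rfl key, Finset.sum_add_distrib, ← Finset.mul_sum, ← Finset.mul_sum] at hd
  linear_combination -hd

variable {S : ℝ}

/-- The continuous function `s ↦ f (s + p²)` on `[0, S]`. -/
def shiftMap (S : ℝ) (f : C(ℝ, ℝ)) (p : Fin 4 → ℤ) : C(Icc (0 : ℝ) S, ℂ) :=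
  ⟨fun s => ((f (s + momSq p) : ℝ) : ℂ), by fun_prop⟩

/-- The denominators as elements of the Banach algebra of continuous functions on `[0, S]`,
depending on the wave function constant and the self-energy. -/
def denomMap (hS : 0 ≤ S) (mr : ℝ) (p : Fin 4 → ℤ) (x : ℂ × C(Icc (0 : ℝ) S, ℂ)) :
    C(Icc (0 : ℝ) S, ℂ) :=
  x.1 • shiftMap S (ContinuousMap.id ℝ) p +
    ((mr : ℂ) ^ 2 + 5 * ContinuousMap.evalCLM ℂ (projIcc 0 S hS 0) x.2 -
      ∑ i, ContinuousMap.evalCLM ℂ (projIcc 0 S hS ((p i : ℝ) ^ 2)) x.2) •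
      (1 : C(Icc (0 : ℝ) S, ℂ)) - x.2

/-- The term `5 σ(0)` comes from eliminating `Z m_b²` through the mass condition. The clamping by
`projIcc` is invisible for the momenta used, whose `p_i²` lie in `[0, S]`. -/
lemma denomMap_apply (hS : 0 ≤ S) (mr : ℝ) (p : Fin 4 → ℤ) (x : ℂ × C(Icc (0 : ℝ) S, ℂ))
    (s : Icc (0 : ℝ) S) : denomMap hS mr p x s =
      x.1 * ((s + momSq p : ℝ) : ℂ) + ((mr : ℂ) ^ 2 + 5 * x.2 (projIcc 0 S hS 0) -
        ∑ i, x.2 (projIcc 0 S hS ((p i : ℝ) ^ 2))) - x.2 s := by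
  simp [denomMap, shiftMap]

lemma contDiff_evalCLM {X : Type*} [TopologicalSpace X] [CompactSpace X] (a : X) :
    ContDiff ℂ ω fun f : C(X, ℂ) => ContinuousMap.evalCLM ℂ a f := by
  exact ContinuousLinearMap.contDiff (ContinuousMap.evalCLM ℂ a : C(X, ℂ) →L[ℂ] ℂ)

lemma denomMap_contDiff (hS : 0 ≤ S) (mr : ℝ) (p : Fin 4 → ℤ) :
    ContDiff ℂ ω (denomMap hS mr p) := by
  have h : ∀ a : Icc (0 : ℝ) S, ContDiff ℂ ω fun x : ℂ × C(Icc (0 : ℝ) S, ℂ) =>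
      ContinuousMap.evalCLM ℂ a x.2 := fun a =>
    (contDiff_evalCLM a).comp contDiff_snd
  exact ((contDiff_fst.smul contDiff_const).add
    (((contDiff_const.add (contDiff_const.mul (h _))).sub
      (ContDiff.sum fun i _ => h _)).smul contDiff_const)).sub contDiff_snd

lemma isUnit_denomMap (hS : 0 ≤ S) {mr : ℝ} (hmr : 0 < mr) (p : Fin 4 → ℤ) :
    IsUnit (denomMap hS mr p (1, 0)) := by
  rw [ContinuousMap.isUnit_iff_forall_ne_zero]
  intro s
  rw [denomMap_apply]
  have h1 := momSq_nonneg p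
  have h2 : 0 ≤ (s : ℝ) := s.2.1
  have h3 : ((s : ℝ) + momSq p + mr ^ 2 : ℝ) ≠ 0 := by positivity
  have h4 : (((s : ℝ) + momSq p + mr ^ 2 : ℝ) : ℂ) ≠ 0 := by exact_mod_cast h3
  simpa using h4

/-- The first-order variation `U` such that the melonic equations read `x = (1, 0) + g U(x)`. -/
def melonicMap (hS : 0 ≤ S) (mr : ℝ) (κ : C(ℝ, ℝ)) (P : Finset (Fin 4 → ℤ))
    (x : ℂ × C(Icc (0 : ℝ) S, ℂ)) : ℂ × C(Icc (0 : ℝ) S, ℂ) :=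
  (-(x.1 ^ 2 * ∑ p ∈ P, (((deriv κ (momSq p) : ℝ) : ℂ) *
      ContinuousMap.evalCLM ℂ (projIcc 0 S hS 0) (Ring.inverse (denomMap hS mr p x)) -
      ((κ (momSq p) : ℝ) : ℂ) *
        ContinuousMap.evalCLM ℂ (projIcc 0 S hS 0) (Ring.inverse (denomMap hS mr p x)) ^ 2)),
    -(x.1 ^ 2 • ∑ p ∈ P, shiftMap S κ p * Ring.inverse (denomMap hS mr p x)))

/-- Apart from polynomials and continuous linear maps, the only operation is inversion in the Banach
algebra `C([0, S], ℂ)`, analytic at units. -/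
lemma melonicMap_contDiffAt (hS : 0 ≤ S) {mr : ℝ} (hmr : 0 < mr) (κ : C(ℝ, ℝ))
    (P : Finset (Fin 4 → ℤ)) : ContDiffAt ℂ ω (melonicMap hS mr κ P) (1, 0) := by
  have hinv : ∀ p, ContDiffAt ℂ ω (fun x => Ring.inverse (denomMap hS mr p x)) (1, 0) := by
    intro p
    obtain ⟨u, hu⟩ := isUnit_denomMap hS hmr p
    have h1 : ContDiffAt ℂ ω Ring.inverse (denomMap hS mr p (1, 0)) := by
      rw [← hu]
      exact contDiffAt_ringInverse ℂ u
    exact h1.comp _ (denomMap_contDiff hS mr p).contDiffAt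
  have hev : ∀ p, ContDiffAt ℂ ω (fun x => ContinuousMap.evalCLM ℂ (projIcc 0 S hS 0)
      (Ring.inverse (denomMap hS mr p x))) (1, 0) := fun p =>
    (contDiff_evalCLM (projIcc 0 S hS 0)).contDiffAt.comp _ (hinv p)
  refine ContDiffAt.prodMk ?_ ?_
  · exact ((contDiffAt_fst.pow 2).mul (ContDiffAt.sum fun p _ =>
      (contDiffAt_const.mul (hev p)).sub (contDiffAt_const.mul ((hev p).pow 2)))).neg
  · exact ((contDiffAt_fst.pow 2).smul (ContDiffAt.sum fun p _ =>
      contDiffAt_const.mul (hinv p))).neg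

lemma ringInverse_apply {X : Type*} [TopologicalSpace X] {f : C(X, ℂ)} (hf : IsUnit f) (a : X) :
    Ring.inverse f a = (f a)⁻¹ := by
  have h := Ring.mul_inverse_cancel f hf
  exact eq_inv_of_mul_eq_one_right (by simpa using DFunLike.congr_fun h a)

end Existence

/-! ### From the fixed point to a melonic family -/

section Family

open scoped ContDiff

variable {M : ℕ} {χ : ℝ → ℝ} {jmax : ℕ} {mr : ℝ}

lemma mem_latticeBox_of_kappaAt_ne_zero (hM : 1 < M) (hχ : IsBump χ) {s : ℝ}
    (hs : 0 ≤ s) {p : Fin 4 → ℤ} (h : kappaAt M χ jmax (s + momSq p) ≠ 0) :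
    p ∈ latticeBox M jmax ∧ s < (2 * (M : ℝ) ^ jmax) ^ 2 := by
  have h1 : s + momSq p < 4 * ((M : ℝ) ^ jmax) ^ 2 := by
    by_contra hcon
    exact h (kappaAt_eq_zero hM hχ (not_lt.1 hcon))
  have := momSq_nonneg p
  exact ⟨mem_latticeBox (by linarith), by linarith⟩

lemma tsum_twoPoint (hM : 1 < M) (hχ : IsBump χ) (B : BareData) {s : ℝ} (hs : 0 ≤ s) :
    ∑' p : Fin 4 → ℤ, B.twoPoint M χ jmax s p = ∑ p ∈ latticeBox M jmax,
      (kappaAt M χ jmax (s + momSq p) : ℂ) / B.gammaTwo s p := by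
  refine tsum_eq_sum fun p hp => ?_
  have : kappaAt M χ jmax (s + momSq p) = 0 := by
    by_contra h
    exact hp (mem_latticeBox_of_kappaAt_ne_zero hM hχ hs h).1
  rw [BareData.twoPoint, this, Complex.ofReal_zero, zero_div]

lemma BareData.gammaTwo_sub (B : BareData) (s : ℝ) (p : Fin 4 → ℤ) :
    B.gammaTwo s p = B.gammaTwo 0 p + B.Z * (s : ℂ) - (B.Sigma s - B.Sigma 0) := by
  simp only [BareData.gammaTwo]
  push_cast
  ring

lemma hasDerivWithinAt_ofReal_comp_add {f : ℝ → ℝ} (hf : Differentiable ℝ f) (a : ℝ) :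
    HasDerivWithinAt (fun s => ((f (s + a) : ℝ) : ℂ)) ((deriv f a : ℝ) : ℂ) (Ici 0) 0 := by
  have h : HasDerivAt (fun s => f (s + a)) (deriv f a) 0 := by
    have := (hf (0 + a)).hasDerivAt.comp_add_const 0 a
    rwa [zero_add] at this
  exact h.ofReal_comp.hasDerivWithinAt

lemma exists_melonicFamily (hM : 1 < M) (hχ : IsBump χ) (hmr : 0 < mr) (jmax : ℕ) :
    ∃ B : ℂ → BareData, IsMelonicFamily M χ jmax mr B := by
  -- At this squared momentum the cutoff has already vanished and the squared components of all box
  -- momenta lie below it, so the self-energy equation closes on `[0, S]`.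
  set S : ℝ := (2 * (M : ℝ) ^ jmax) ^ 2 with hSdef
  have hM0 : (0 : ℝ) < M := by exact_mod_cast hM.le
  have hSpos : 0 < S := by positivity
  have hS : 0 ≤ S := hSpos.le
  have hκd : Differentiable ℝ (kappaAt M χ jmax) :=
    (kappaAt_contDiff hχ jmax).differentiable (by simp)
  set κ : C(ℝ, ℝ) := ⟨kappaAt M χ jmax, hκd.continuous⟩ with hκ
  set P := latticeBox M jmax with hP
  obtain ⟨x, hxan, hx0, hxfix⟩ := exists_analyticAt_fixed_point (melonicMap_contDiffAt hS hmr κ P)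
  have hxc : Tendsto x (𝓝 0) (𝓝 (1, 0)) := hx0 ▸ hxan.continuousAt
  have hDc : ∀ p, Tendsto (fun g => denomMap hS mr p (x g)) (𝓝 0) (𝓝 (denomMap hS mr p (1, 0))) :=
    fun p => ((denomMap_contDiff hS mr p).continuous.tendsto _).comp hxc
  have hunit : ∀ᶠ g in 𝓝 (0 : ℂ), ∀ p ∈ P, IsUnit (denomMap hS mr p (x g)) :=
    (eventually_all_finset P).2 fun p _ =>
      (hDc p).eventually (Units.isOpen.mem_nhds (isUnit_denomMap hS hmr p))
  have hZc : Tendsto (fun g => (x g).1) (𝓝 0) (𝓝 1) := (continuous_fst.tendsto _).comp hxc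
  have hZne : ∀ᶠ g in 𝓝 (0 : ℂ), (x g).1 ≠ 0 := hZc.eventually_ne one_ne_zero
  have hA : ∀ᶠ g in 𝓝 (0 : ℂ), 1 + g * (x g).1 ^ 2 * ∑ p ∈ P,
      ((κ (0 + momSq p) : ℝ) : ℂ) / denomMap hS mr p (x g) (projIcc 0 S hS 0) ^ 2 ≠ 0 := by
    have h1 : ∀ p, Tendsto (fun g => denomMap hS mr p (x g) (projIcc 0 S hS 0)) (𝓝 0)
        (𝓝 (denomMap hS mr p (1, 0) (projIcc 0 S hS 0))) := fun p =>
      ((contDiff_evalCLM (projIcc 0 S hS 0)).continuous.tendsto _).comp (hDc p)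
    have h2 : Tendsto (fun g => 1 + g * (x g).1 ^ 2 * ∑ p ∈ P,
        ((κ (0 + momSq p) : ℝ) : ℂ) / denomMap hS mr p (x g) (projIcc 0 S hS 0) ^ 2) (𝓝 0)
        (𝓝 (1 + 0 * 1 ^ 2 * ∑ p ∈ P, ((κ (0 + momSq p) : ℝ) : ℂ) /
          denomMap hS mr p (1, 0) (projIcc 0 S hS 0) ^ 2)) := by
      refine tendsto_const_nhds.add ((tendsto_id.mul (hZc.pow 2)).mul
        (tendsto_finsetSum _ fun p _ => tendsto_const_nhds.div ((h1 p).pow 2) (pow_ne_zero 2 ?_)))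
      exact (ContinuousMap.isUnit_iff_forall_ne_zero _).1 (isUnit_denomMap hS hmr p) _
    exact h2.eventually_ne (by simp)
  obtain ⟨r, hr, hball⟩ := Metric.eventually_nhds_iff_ball.1
    (hxan.eventually_analyticAt.and (hxfix.and (hunit.and (hZne.and hA))))
  -- The mass is read off from the mass condition. Beyond `S` no propagator survives, which forces
  -- the self-energy to be zero there.
  set B : ℂ → BareData := fun g =>
    { Z := (x g).1
      massSq := ((mr : ℂ) ^ 2 + 5 * (x g).2 (projIcc 0 S hS 0)) / (x g).1
      Sigma := fun s => if s ≤ S then (x g).2 (projIcc 0 S hS s) else 0 } with hB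
  have hev : ∀ a, ∀ g ∈ Metric.ball (0 : ℂ) r, AnalyticAt ℂ (fun g => (x g).2 a) g :=
    fun a g hg => AnalyticAt.comp (contDiff_evalCLM a).contDiffAt.analyticAt
      (analyticAt_snd.comp (hball g hg).1)
  have hZan : ∀ g ∈ Metric.ball (0 : ℂ) r, AnalyticAt ℂ (fun g => (x g).1) g :=
    fun g hg => analyticAt_fst.comp (hball g hg).1
  refine ⟨B, r, hr, hZan, fun g hg => ?_, fun s _ g hg => ?_, fun g hg => ?_⟩
  · exact (analyticAt_const.add (analyticAt_const.mul (hev _ g hg))).div (hZan g hg)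
      (hball g hg).2.2.2.1
  · by_cases h : s ≤ S
    · simp only [hB, if_pos h]
      exact hev _ g hg
    · simp only [hB, if_neg h]
      exact analyticAt_const
  obtain ⟨-, hfix, hu, hZ0, hAg⟩ := hball g hg
  have hne : ∀ p ∈ P, ∀ a, denomMap hS mr p (x g) a ≠ 0 := fun p hp =>
    (ContinuousMap.isUnit_iff_forall_ne_zero _).1 (hu p hp)
  have hSig0 : (B g).Sigma 0 = (x g).2 (projIcc 0 S hS 0) := by simp only [hB, if_pos hS]
  have hγ : ∀ p ∈ P, ∀ s, 0 ≤ s → s ≤ S →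
      (B g).gammaTwo s p = denomMap hS mr p (x g) (projIcc 0 S hS s) := by
    intro p hp s h0 h1
    have h2 : ∀ i, (B g).Sigma ((p i : ℝ) ^ 2) = (x g).2 (projIcc 0 S hS ((p i : ℝ) ^ 2)) :=
      fun i => if_pos (mem_latticeBox_iff.1 hp i)
    have h3 : (B g).Sigma s = (x g).2 (projIcc 0 S hS s) := if_pos h1
    have h4 : (B g).Z * (B g).massSq = (mr : ℂ) ^ 2 + 5 * (x g).2 (projIcc 0 S hS 0) :=
      mul_div_cancel₀ _ hZ0
    rw [denomMap_apply, BareData.gammaTwo, mul_add, h4, h3]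
    simp only [h2]
    rw [projIcc_of_mem hS ⟨h0, h1⟩]
    simp only [hB]
    ring
  have hSigma : ∀ s, 0 ≤ s → (B g).Sigma s = -(g * (B g).Z ^ 2) * ∑ p ∈ P,
      (kappaAt M χ jmax (s + momSq p) : ℂ) / (B g).gammaTwo s p := by
    intro s h0
    by_cases h1 : s ≤ S
    · have e : (B g).Sigma s = (x g).2 (projIcc 0 S hS s) := if_pos h1
      have h2 := congrArg (fun y => y.2 (projIcc 0 S hS s)) hfix
      simp only [Prod.snd_add, Prod.smul_snd, melonicMap, zero_add, ContinuousMap.smul_apply,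
        ContinuousMap.neg_apply, ContinuousMap.coe_sum, Finset.sum_apply, ContinuousMap.mul_apply,
        smul_eq_mul] at h2
      rw [e, h2, neg_mul, mul_neg, mul_assoc]
      congr 3
      refine Finset.sum_congr rfl fun p hp => ?_
      rw [ringInverse_apply (hu p hp), hγ p hp s h0 h1, div_eq_mul_inv]
      congr 1
      simp [shiftMap, projIcc_of_mem hS ⟨h0, h1⟩, hκ]
    · have e : (B g).Sigma s = 0 := if_neg h1
      rw [e, Finset.sum_eq_zero, mul_zero]
      intro p _
      have : kappaAt M χ jmax (s + momSq p) = 0 := by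
        by_contra h
        exact h1 (mem_latticeBox_of_kappaAt_ne_zero hM hχ h0 h).2.le
      rw [this, Complex.ofReal_zero, zero_div]
  refine ⟨fun s hs p hκp => ?_, fun s hs => ?_, ?_, ?_⟩
  · obtain ⟨hp, hsS⟩ := mem_latticeBox_of_kappaAt_ne_zero hM hχ hs hκp
    rw [hγ p hp s hs hsS.le]
    exact hne p hp _
  · rw [tsum_twoPoint hM hχ _ hs, hSigma s hs]
    ring
  · rw [hSig0]
    have h4 : (B g).Z * (B g).massSq = (mr : ℂ) ^ 2 + 5 * (x g).2 (projIcc 0 S hS 0) :=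
      mul_div_cancel₀ _ hZ0
    rw [h4]
    ring
  -- The fixed point supplies only a continuous `Σ`, and its first component encodes the wave
  -- function condition with the slope of the denominators replaced by `1`. Differentiability at `0`
  -- with slope `Z - 1` is recovered here.
  · refine hasDerivWithinAt_of_fixed_point P (lam := g * (B g).Z ^ 2)
      (k := fun p s => (kappaAt M χ jmax (s + momSq p) : ℂ)) (D := fun p s => (B g).gammaTwo s p)
      (k' := fun p => ((deriv (kappaAt M χ jmax) (momSq p) : ℝ) : ℂ))
      (fun p _ => hasDerivWithinAt_ofReal_comp_add hκd _) ?_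
      (fun p _ s => (B g).gammaTwo_sub s p) (fun p hp => ?_) ?_ ?_ ?_
    · have h1 : ContinuousAt (fun s => (x g).2 (projIcc 0 S hS s)) 0 := by fun_prop
      refine (h1.congr ?_).continuousWithinAt
      filter_upwards [gt_mem_nhds hSpos] with s hs
      exact (if_pos (le_of_lt hs)).symm
    · rw [hγ p hp 0 le_rfl hS]
      exact hne p hp _
    · filter_upwards [self_mem_nhdsWithin] with s hs using hSigma s hs
    · refine ne_of_eq_of_ne ?_ hAg
      congr 2
      refine Finset.sum_congr rfl fun p hp => ?_
      rw [hγ p hp 0 le_rfl hS]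
      rfl
    · have h2 := congrArg Prod.fst hfix
      simp only [Prod.fst_add, Prod.smul_fst, melonicMap, smul_eq_mul] at h2
      have h3 : (B g).Z = (x g).1 := rfl
      rw [sub_eq_iff_eq_add, h3]
      refine h2.trans ?_
      rw [add_comm, mul_neg, neg_mul, mul_assoc]
      congr 4
      refine Finset.sum_congr rfl fun p hp => ?_
      rw [hγ p hp 0 le_rfl hS, ContinuousMap.evalCLM_apply, ringInverse_apply (hu p hp), zero_add]
      simp only [div_eq_mul_inv, inv_pow]
      rfl

end Family

/-! ### Expansion of the effective constants -/

section Expansion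

variable {M : ℕ} {χ : ℝ → ℝ} {jmax : ℕ} {mr : ℝ} {B : ℂ → BareData}

lemma BareData.IsSolution.denomMr_eq {g : ℂ} {B : BareData} (hB : B.IsSolution M χ jmax mr g)
    (s : ℝ) (p : Fin 4 → ℤ) : B.denomMr mr B.sigmaMr s p = B.gammaTwo s p := by
  simp only [BareData.denomMr, BareData.sigmaMr, BareData.gammaTwo, hB.mass_renormalization,
    Finset.sum_sub_distrib, Finset.sum_const, Finset.card_univ, Fintype.card_fin, nsmul_eq_mul]
  push_cast
  ring

lemma IsMelonicFamily.analyticAt_Z (hB : IsMelonicFamily M χ jmax mr B) :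
    AnalyticAt ℂ (fun g => (B g).Z) 0 := by
  obtain ⟨r, hr, hZ, -, -, -⟩ := hB
  exact hZ 0 (Metric.mem_ball_self hr)

lemma IsMelonicFamily.analyticAt_gammaTwo (hB : IsMelonicFamily M χ jmax mr B) {s : ℝ}
    (hs : 0 ≤ s) (p : Fin 4 → ℤ) : AnalyticAt ℂ (fun g => (B g).gammaTwo s p) 0 := by
  obtain ⟨r, hr, hZ, hm, hS, -⟩ := hB
  have h0 := Metric.mem_ball_self (x := (0 : ℂ)) hr
  exact ((hZ 0 h0).mul (analyticAt_const.add (hm 0 h0))).sub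
    ((hS s hs 0 h0).add (Finset.analyticAt_fun_sum _ fun i _ => hS _ (sq_nonneg _) 0 h0))

lemma IsMelonicFamily.eventually_isSolution (hB : IsMelonicFamily M χ jmax mr B) :
    ∀ᶠ g in 𝓝 (0 : ℂ), (B g).IsSolution M χ jmax mr g := by
  obtain ⟨r, hr, -, -, -, h⟩ := hB
  exact Metric.eventually_nhds_iff_ball.2 ⟨r, hr, h⟩

/-- The equation carries a factor `g`. Hence at `g = 0` every family, not only the constructed one,
is the free theory. -/
lemma BareData.IsSolution.Sigma_zero {B : BareData} (hB : B.IsSolution M χ jmax mr 0) {s : ℝ}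
    (hs : 0 ≤ s) : B.Sigma s = 0 := by
  rw [hB.selfEnergy_eq s hs]
  simp

lemma BareData.IsSolution.Z_eq_one {B : BareData} (hB : B.IsSolution M χ jmax mr 0) :
    B.Z = 1 := by
  have h1 : HasDerivWithinAt B.Sigma 0 (Ici 0) 0 :=
    (hasDerivWithinAt_const (0 : ℝ) (Ici 0) (0 : ℂ)).congr (fun s hs => hB.Sigma_zero hs)
      (hB.Sigma_zero le_rfl)
  exact sub_eq_zero.1 ((uniqueDiffWithinAt_Ici 0).eq_deriv _ hB.wave_renormalization h1)

lemma BareData.IsSolution.gammaTwo_zero {B : BareData} (hB : B.IsSolution M χ jmax mr 0) {s : ℝ}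
    (hs : 0 ≤ s) (p : Fin 4 → ℤ) : B.gammaTwo s p = ((s + momSq p + mr ^ 2 : ℝ) : ℂ) := by
  have h := hB.mass_renormalization
  rw [hB.Sigma_zero le_rfl, mul_zero, sub_zero, hB.Z_eq_one, one_mul] at h
  have h2 : ∀ i, B.Sigma ((p i : ℝ) ^ 2) = 0 := fun i => hB.Sigma_zero (sq_nonneg _)
  simp only [BareData.gammaTwo, mul_add, ← h, hB.Sigma_zero hs, hB.Z_eq_one, h2]
  push_cast
  simp

lemma IsMelonicFamily.isSolution_zero (hB : IsMelonicFamily M χ jmax mr B) :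
    (B 0).IsSolution M χ jmax mr 0 := hB.eventually_isSolution.self_of_nhds

lemma IsMelonicFamily.gammaTwo_zero_ne (hmr : 0 < mr) (hB : IsMelonicFamily M χ jmax mr B) {s : ℝ}
    (hs : 0 ≤ s) (p : Fin 4 → ℤ) : (B 0).gammaTwo s p ≠ 0 := by
  rw [hB.isSolution_zero.gammaTwo_zero hs]
  have := momSq_nonneg p
  have : s + momSq p + mr ^ 2 ≠ 0 := by positivity
  exact_mod_cast this

/-- The one-loop sum giving the wave function renormalization due to a cutoff `e`. -/
def BareData.waveSum (B : BareData) (P : Finset (Fin 4 → ℤ)) (e : ℝ → ℝ) : ℂ :=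
  B.Z ^ 2 * ∑ p ∈ P, (((e (momSq p) : ℝ) : ℂ) / B.gammaTwo 0 p ^ 2 -
    ((deriv e (momSq p) : ℝ) : ℂ) / B.gammaTwo 0 p)

lemma IsMelonicFamily.analyticAt_waveSum (hmr : 0 < mr) (hB : IsMelonicFamily M χ jmax mr B)
    (P : Finset (Fin 4 → ℤ)) (e : ℝ → ℝ) : AnalyticAt ℂ (fun g => (B g).waveSum P e) 0 := by
  have h := fun p => hB.analyticAt_gammaTwo le_rfl p
  have hne := fun p => hB.gammaTwo_zero_ne hmr le_rfl p
  exact (hB.analyticAt_Z.pow 2).mul (Finset.analyticAt_fun_sum _ fun p _ =>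
    (analyticAt_const.div ((h p).pow 2) (pow_ne_zero 2 (hne p))).sub
      (analyticAt_const.div (h p) (hne p)))

lemma BareData.IsSolution.waveSum_zero {B : BareData} (hB : B.IsSolution M χ jmax mr 0)
    (P : Finset (Fin 4 → ℤ)) (e : ℝ → ℝ) :
    B.waveSum P e = ((∑ p ∈ P, (e (momSq p) / (momSq p + mr ^ 2) ^ 2 -
      deriv e (momSq p) / (momSq p + mr ^ 2)) : ℝ) : ℂ) := by
  simp only [BareData.waveSum, hB.Z_eq_one, hB.gammaTwo_zero le_rfl, zero_add]
  push_cast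
  simp

/-- The slope is `Z - Σ'(0)`, which the wave function condition sets to `1`; no unknown derivative
of `Σ` enters the later expansions. -/
lemma BareData.IsSolution.hasDerivWithinAt_gammaTwo {g : ℂ} {B : BareData}
    (hB : B.IsSolution M χ jmax mr g) (p : Fin 4 → ℤ) :
    HasDerivWithinAt (fun s => B.gammaTwo s p) 1 (Ici 0) 0 := by
  have h1 : HasDerivWithinAt (fun s : ℝ => B.Z * (s : ℂ)) (B.Z * 1) (Ici 0) 0 :=
    (Complex.ofRealCLM.hasDerivAt.hasDerivWithinAt).const_mul B.Z
  have h2 := (h1.const_add (B.gammaTwo 0 p)).sub (hB.wave_renormalization.sub_const (B.Sigma 0))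
  have h3 : (fun s : ℝ => B.gammaTwo s p) =
      fun s : ℝ => B.gammaTwo 0 p + B.Z * (s : ℂ) - (B.Sigma s - B.Sigma 0) :=
    funext fun s => B.gammaTwo_sub s p
  rw [h3]
  exact h2.congr_deriv (by ring)

/-- The quotient rule with unit denominator slope. Taking `e = κ` yields `Z_b - 1`, and `e = η_{≥
j}` yields the wave function correction of the scales `≥ j`. -/
lemma BareData.IsSolution.hasDerivWithinAt_sum {g : ℂ} {B : BareData}
    (hB : B.IsSolution M χ jmax mr g) {P : Finset (Fin 4 → ℤ)}
    (hne : ∀ p ∈ P, B.gammaTwo 0 p ≠ 0) {e : ℝ → ℝ} (he : Differentiable ℝ e)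
    (c : (Fin 4 → ℤ) → ℂ) :
    HasDerivWithinAt (fun s => -g * B.Z ^ 2 * ∑ p ∈ P,
      (((e (s + momSq p) : ℝ) : ℂ) / B.gammaTwo s p - c p)) (g * B.waveSum P e) (Ici 0) 0 := by
  have h := (HasDerivWithinAt.fun_sum (u := P) fun p hp =>
    (((hasDerivWithinAt_ofReal_comp_add he (momSq p)).fun_div
      (hB.hasDerivWithinAt_gammaTwo p) (hne p hp)).sub_const (c p))).const_mul (-g * B.Z ^ 2)
  refine h.congr_deriv ?_
  rw [BareData.waveSum, neg_mul, neg_mul, ← mul_neg, ← Finset.sum_neg_distrib, mul_assoc]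
  congr 2
  refine Finset.sum_congr rfl fun p hp => ?_
  have := hne p hp
  rw [zero_add]
  field_simp
  ring

lemma IsMelonicFamily.eventually_gammaTwo_ne (hmr : 0 < mr) (hB : IsMelonicFamily M χ jmax mr B)
    (P : Finset (Fin 4 → ℤ)) : ∀ᶠ g in 𝓝 (0 : ℂ), ∀ p ∈ P, (B g).gammaTwo 0 p ≠ 0 :=
  (eventually_all_finset P).2 fun p _ =>
    (hB.analyticAt_gammaTwo le_rfl p).continuousAt.eventually_ne (hB.gammaTwo_zero_ne hmr le_rfl p)

lemma IsMelonicFamily.eventually_Z_eq (hM : 1 < M) (hχ : IsBump χ) (hmr : 0 < mr)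
    (hB : IsMelonicFamily M χ jmax mr B) : ∀ᶠ g in 𝓝 (0 : ℂ),
      (B g).Z = 1 + g * (B g).waveSum (latticeBox M jmax) (kappaAt M χ jmax) := by
  filter_upwards [hB.eventually_isSolution, hB.eventually_gammaTwo_ne hmr (latticeBox M jmax)]
    with g hg hne
  have h1 := hg.hasDerivWithinAt_sum hne (e := kappaAt M χ jmax)
    ((kappaAt_contDiff hχ jmax).differentiable (by simp)) 0
  have h2 : HasDerivWithinAt (B g).Sigma
      (g * (B g).waveSum (latticeBox M jmax) (kappaAt M χ jmax)) (Ici 0) 0 := by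
    refine h1.congr_of_mem (fun s hs => ?_) self_mem_Ici
    rw [hg.selfEnergy_eq s hs, tsum_twoPoint hM hχ _ hs]
    simp only [Pi.zero_apply, sub_zero]
  rw [← (uniqueDiffWithinAt_Ici 0).eq_deriv _ hg.wave_renormalization h2]
  ring

lemma etaGe_eq_zero (hM : 1 < M) (hχ : IsBump χ) {j : ℤ} (hj : 0 ≤ j) {x : ℝ}
    (hx : 4 * ((M : ℝ) ^ jmax) ^ 2 < x) : etaGe M χ jmax j x = 0 := by
  rcases lt_or_ge (jmax : ℤ) j with h | h
  · exact etaGe_of_lt h x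
  obtain ⟨n, rfl⟩ := Int.eq_ofNat_of_zero_le hj
  rcases n with _ | n
  · rw [Nat.cast_zero, etaGe_zero, kappaAt_eq_zero hM hχ hx.le]
  · have h1 : (1 : ℝ) ≤ M := by exact_mod_cast hM.le
    have h2 : n ≤ jmax := by omega
    have h3 : 4 * ((M : ℝ) ^ n) ^ 2 ≤ x := le_trans (by gcongr) hx.le
    rw [Nat.cast_succ, etaGe_succ n h2, kappaAt_eq_zero hM hχ hx.le,
      kappaAt_eq_zero hM hχ h3, sub_zero]

lemma etaGe_eq_zero_of_notMem (hM : 1 < M) (hχ : IsBump χ) {j : ℤ} (hj : 0 ≤ j) {s : ℝ}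
    (hs : 0 ≤ s) {p : Fin 4 → ℤ} (hp : p ∉ latticeBox M jmax) :
    etaGe M χ jmax j (s + momSq p) = 0 := by
  refine etaGe_eq_zero hM hχ hj ?_
  by_contra h
  exact hp (mem_latticeBox (by linarith))

lemma BareData.IsSolution.sigmaMrGe_eq (hM : 1 < M) (hχ : IsBump χ) {g : ℂ} {B : BareData}
    (hB : B.IsSolution M χ jmax mr g) {j : ℤ} (hj : 0 ≤ j) {s : ℝ} (hs : 0 ≤ s) :
    B.sigmaMrGe M χ jmax mr g j s = -g * B.Z ^ 2 * ∑ p ∈ latticeBox M jmax,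
      (((etaGe M χ jmax j (s + momSq p) : ℝ) : ℂ) / B.gammaTwo s p -
        ((etaGe M χ jmax j (0 + momSq p) : ℝ) : ℂ) / B.gammaTwo 0 p) := by
  rw [BareData.sigmaMrGe]
  simp only [hB.denomMr_eq]
  rw [tsum_eq_sum fun p hp => ?_]
  rw [etaGe_eq_zero_of_notMem hM hχ hj hs hp, etaGe_eq_zero_of_notMem hM hχ hj le_rfl hp]
  simp

lemma IsMelonicFamily.eventually_hasDerivWithinAt_sigmaMrGe (hM : 1 < M) (hχ : IsBump χ)
    (hmr : 0 < mr) (hB : IsMelonicFamily M χ jmax mr B) {j : ℤ} (hj : 0 ≤ j) :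
    ∀ᶠ g in 𝓝 (0 : ℂ), HasDerivWithinAt ((B g).sigmaMrGe M χ jmax mr g j)
      (g * (B g).waveSum (latticeBox M jmax) (etaGe M χ jmax j)) (Ici 0) 0 := by
  filter_upwards [hB.eventually_isSolution, hB.eventually_gammaTwo_ne hmr (latticeBox M jmax)]
    with g hg hne
  exact (hg.hasDerivWithinAt_sum hne ((etaGe_contDiff hχ jmax j).differentiable (by simp))
    _).congr_of_mem (fun s hs => hg.sigmaMrGe_eq hM hχ hj hs) self_mem_Ici

lemma IsMelonicFamily.eventually_effZ_eq (hM : 1 < M) (hχ : IsBump χ) (hmr : 0 < mr)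
    (hB : IsMelonicFamily M χ jmax mr B) {j : ℤ} (hj : -1 ≤ j) : ∀ᶠ g in 𝓝 (0 : ℂ),
      effZ M χ jmax mr B j g = 1 + g * ((B g).waveSum (latticeBox M jmax) (kappaAt M χ jmax) -
        (B g).waveSum (latticeBox M jmax) (etaGe M χ jmax (j + 1))) := by
  filter_upwards [hB.eventually_hasDerivWithinAt_sigmaMrGe hM hχ hmr (j := j + 1) (by omega),
    hB.eventually_Z_eq hM hχ hmr] with g h1 h2
  rw [effZ, h1.derivWithin (uniqueDiffWithinAt_Ici 0), h2]
  ring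

lemma IsMelonicFamily.analyticAt_sigmaMrGe (hM : 1 < M) (hχ : IsBump χ) (hmr : 0 < mr)
    (hB : IsMelonicFamily M χ jmax mr B) {j : ℤ} (hj : 0 ≤ j) {s : ℝ} (hs : 0 ≤ s) :
    AnalyticAt ℂ (fun g => (B g).sigmaMrGe M χ jmax mr g j s) 0 := by
  have h : AnalyticAt ℂ (fun g => -g * (B g).Z ^ 2 * ∑ p ∈ latticeBox M jmax,
      (((etaGe M χ jmax j (s + momSq p) : ℝ) : ℂ) / (B g).gammaTwo s p -
        ((etaGe M χ jmax j (0 + momSq p) : ℝ) : ℂ) / (B g).gammaTwo 0 p)) 0 :=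
    (analyticAt_id.neg.mul (hB.analyticAt_Z.pow 2)).mul (Finset.analyticAt_fun_sum _ fun p _ =>
      (analyticAt_const.div (hB.analyticAt_gammaTwo hs p) (hB.gammaTwo_zero_ne hmr hs p)).sub
        (analyticAt_const.div (hB.analyticAt_gammaTwo le_rfl p)
          (hB.gammaTwo_zero_ne hmr le_rfl p)))
  refine h.congr ?_
  filter_upwards [hB.eventually_isSolution] with g hg
  exact (hg.sigmaMrGe_eq hM hχ hj hs).symm

/-- The bubble sum in the four-point function at vanishing external momenta. -/
def BareData.bubbleSum (M : ℕ) (χ : ℝ → ℝ) (jmax : ℕ) (mr : ℝ) (g : ℂ) (B : BareData)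
    (j : ℤ) : ℂ :=
  ∑ p ∈ latticeBox M jmax, B.twoPointMrGe M χ jmax mr g j 0 p ^ 2

lemma BareData.gammaFourGe_zero (hM : 1 < M) (hχ : IsBump χ) (g : ℂ) (B : BareData) {j : ℤ}
    (hj : 0 ≤ j) : B.gammaFourGe M χ jmax mr g j 0 0 =
      (-g * B.Z ^ 2) / (1 + g * B.Z ^ 2 * B.bubbleSum M χ jmax mr g j) := by
  rw [BareData.gammaFourGe, BareData.bubbleSum, tsum_eq_sum (s := latticeBox M jmax)]
  · simp [sq]
  · intro p hp
    have : B.twoPointMrGe M χ jmax mr g j (((0 : ℤ) : ℝ) ^ 2) p = 0 := by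
      rw [BareData.twoPointMrGe, etaGe_eq_zero_of_notMem hM hχ hj (by positivity) hp,
        Complex.ofReal_zero, zero_div]
    rw [this, zero_mul]

lemma IsMelonicFamily.denomMr_sigmaMrGe_zero (hB : IsMelonicFamily M χ jmax mr B) (j : ℤ)
    (p : Fin 4 → ℤ) : (B 0).denomMr mr ((B 0).sigmaMrGe M χ jmax mr 0 j) 0 p =
      ((momSq p + mr ^ 2 : ℝ) : ℂ) := by
  simp only [BareData.denomMr, BareData.sigmaMrGe, hB.isSolution_zero.Z_eq_one]
  push_cast
  simp

lemma IsMelonicFamily.bubbleSum_zero (hB : IsMelonicFamily M χ jmax mr B) (j : ℤ) :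
    (B 0).bubbleSum M χ jmax mr 0 j = ((∑ p ∈ latticeBox M jmax,
      etaGe M χ jmax j (momSq p) ^ 2 / (momSq p + mr ^ 2) ^ 2 : ℝ) : ℂ) := by
  simp only [BareData.bubbleSum, BareData.twoPointMrGe, hB.denomMr_sigmaMrGe_zero, zero_add,
    div_pow]
  push_cast
  rfl

lemma IsMelonicFamily.analyticAt_bubbleSum (hM : 1 < M) (hχ : IsBump χ) (hmr : 0 < mr)
    (hB : IsMelonicFamily M χ jmax mr B) {j : ℤ} (hj : 0 ≤ j) :
    AnalyticAt ℂ (fun g => (B g).bubbleSum M χ jmax mr g j) 0 := by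
  refine Finset.analyticAt_fun_sum _ fun p _ =>
    AnalyticAt.pow (AnalyticAt.div analyticAt_const ?_ ?_) 2
  · exact ((hB.analyticAt_Z.mul analyticAt_const).add analyticAt_const).sub
      ((hB.analyticAt_sigmaMrGe hM hχ hmr hj le_rfl).add (Finset.analyticAt_fun_sum _ fun i _ =>
        hB.analyticAt_sigmaMrGe hM hχ hmr hj (sq_nonneg _)))
  · rw [hB.denomMr_sigmaMrGe_zero]
    have := momSq_nonneg p
    have : momSq p + mr ^ 2 ≠ 0 := by positivity
    exact_mod_cast this

lemma hasDerivAt_one_add_id_mul {a : ℂ → ℂ} (ha : AnalyticAt ℂ a 0) :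
    HasDerivAt (fun g => 1 + g * a g) (a 0) 0 := by
  have := ((hasDerivAt_id (0 : ℂ)).mul ha.differentiableAt.hasDerivAt).const_add 1
  refine this.congr_deriv ?_
  simp

/-- The effective wave function and coupling constants are analytic in the bare coupling, with
the expansion of the coupling given to second order by `oneLoop`. -/
lemma IsMelonicFamily.effective_expansion (hM : 1 < M) (hχ : IsBump χ) (hmr : 0 < mr)
    (hB : IsMelonicFamily M χ jmax mr B) {j : ℤ} (hj : -1 ≤ j) :
    AnalyticAt ℂ (effZ M χ jmax mr B j) 0 ∧ effZ M χ jmax mr B j 0 = 1 ∧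
      ∃ U : ℂ → ℂ, AnalyticAt ℂ U 0 ∧ U 0 = 1 ∧
        HasDerivAt U ((oneLoop M χ jmax mr j : ℝ) : ℂ) 0 ∧
        ∀ᶠ g in 𝓝 (0 : ℂ), effG M χ jmax mr B j g = g * U g := by
  have hj' : 0 ≤ j + 1 := by omega
  set P := latticeBox M jmax with hP
  have hκ := hB.analyticAt_waveSum hmr P (kappaAt M χ jmax)
  have hE := hB.analyticAt_waveSum hmr P (etaGe M χ jmax (j + 1))
  have hT := hB.analyticAt_bubbleSum hM hχ hmr hj'
  have hZ := hB.analyticAt_Z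
  have hz := hB.eventually_effZ_eq hM hχ hmr hj
  have hzan : AnalyticAt ℂ (effZ M χ jmax mr B j) 0 :=
    (analyticAt_const.add (analyticAt_id.mul (hκ.sub hE))).congr (hz.mono fun g hg => hg.symm)
  have hz0 : effZ M χ jmax mr B j 0 = 1 := by
    rw [hz.self_of_nhds, zero_mul, add_zero]
  have hZ0 : (B 0).Z = 1 := hB.isSolution_zero.Z_eq_one
  have hZd : HasDerivAt (fun g => (B g).Z) ((B 0).waveSum P (kappaAt M χ jmax)) 0 :=
    (hasDerivAt_one_add_id_mul hκ).congr_of_eventuallyEq (hB.eventually_Z_eq hM hχ hmr)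
  have hzd : HasDerivAt (effZ M χ jmax mr B j) ((B 0).waveSum P (kappaAt M χ jmax) -
      (B 0).waveSum P (etaGe M χ jmax (j + 1))) 0 :=
    (hasDerivAt_one_add_id_mul (hκ.sub hE)).congr_of_eventuallyEq hz
  have hden : AnalyticAt ℂ (fun g => (B g).Z ^ 2 * (B g).bubbleSum M χ jmax mr g (j + 1)) 0 :=
    (hZ.pow 2).mul hT
  have hdend := hasDerivAt_one_add_id_mul hden
  have hne : (1 + 0 * ((B 0).Z ^ 2 * (B 0).bubbleSum M χ jmax mr 0 (j + 1))) *
      effZ M χ jmax mr B j 0 ^ 2 ≠ 0 := by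
    rw [hz0]
    simp
  refine ⟨hzan, hz0, fun g => (B g).Z ^ 2 /
    ((1 + g * ((B g).Z ^ 2 * (B g).bubbleSum M χ jmax mr g (j + 1))) *
      effZ M χ jmax mr B j g ^ 2), ?_, ?_, ?_, ?_⟩
  · exact (hZ.pow 2).div ((analyticAt_const.add (analyticAt_id.mul hden)).mul (hzan.pow 2)) hne
  · simp [hZ0, hz0]
  · have h := (hZd.fun_pow 2).fun_div (hdend.fun_mul (hzd.fun_pow 2)) hne
    refine h.congr_deriv ?_
    -- The derivative is `2 w_κ - 2 (w_κ - w_η)` minus the bubble, with `w` the wave sums at `g =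
    -- 0`: the full-cutoff sum cancels between `Z_b²` and `Z_j²`.
    have e : oneLoop M χ jmax mr j = 2 * ∑ p ∈ P,
        (etaGe M χ jmax (j + 1) (momSq p) / (momSq p + mr ^ 2) ^ 2 -
          deriv (etaGe M χ jmax (j + 1)) (momSq p) / (momSq p + mr ^ 2)) -
        ∑ p ∈ P, etaGe M χ jmax (j + 1) (momSq p) ^ 2 / (momSq p + mr ^ 2) ^ 2 := by
      rw [oneLoop, Finset.sum_sub_distrib, ← Finset.mul_sum]
    rw [hZ0, hz0, hB.bubbleSum_zero, hB.isSolution_zero.waveSum_zero,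
      hB.isSolution_zero.waveSum_zero, e]
    push_cast
    ring
  · refine Eventually.of_forall fun g => ?_
    simp only [effG, BareData.gammaFourGe_zero hM hχ g (B g) hj', neg_mul, neg_div, neg_neg,
      div_div, mul_assoc, mul_div_assoc]

/-- Two couplings tangent to the identity satisfy a discrete flow equation with a one-loop
coefficient and an analytic remainder of third order. -/
lemma exists_flow_remainder {G₀ G₁ U₀ U₁ : ℂ → ℂ} {c₀ c₁ : ℂ} (hU₀ : AnalyticAt ℂ U₀ 0)
    (hU₁ : AnalyticAt ℂ U₁ 0) (h₀ : U₀ 0 = 1) (h₁ : U₁ 0 = 1) (hd₀ : HasDerivAt U₀ c₀ 0)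
    (hd₁ : HasDerivAt U₁ c₁ 0) (hG₀ : ∀ᶠ g in 𝓝 0, G₀ g = g * U₀ g)
    (hG₁ : ∀ᶠ g in 𝓝 0, G₁ g = g * U₁ g) :
    ∃ f : ℂ → ℂ, AnalyticAt ℂ f 0 ∧ ∀ᶠ g in 𝓝 0,
      G₁ g - G₀ g = (c₁ - c₀) * G₀ g ^ 2 + G₀ g ^ 3 * f (G₀ g) := by
  -- `g V(g)` is the flow minus its one-loop term. Since `V` vanishes to second order, two divided
  -- slopes give `V = g² W`.
  set V : ℂ → ℂ := fun g => U₁ g - U₀ g - (c₁ - c₀) * (g * U₀ g ^ 2) with hV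
  have hVan : AnalyticAt ℂ V 0 :=
    (hU₁.sub hU₀).sub (analyticAt_const.mul (analyticAt_id.mul (hU₀.pow 2)))
  have hV0 : V 0 = 0 := by simp [hV, h₀, h₁]
  have hVd : HasDerivAt V 0 0 := by
    have := (hd₁.sub hd₀).sub
      (((hasDerivAt_id (0 : ℂ)).mul (hd₀.fun_pow 2)).const_mul (c₁ - c₀))
    refine this.congr_deriv ?_
    simp [h₀]
  have hds : ∀ {F : ℂ → ℂ}, AnalyticAt ℂ F 0 → AnalyticAt ℂ (dslope F 0) 0 := fun ⟨p, hp⟩ =>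
    hp.has_fpower_series_dslope_fslope.analyticAt
  set W : ℂ → ℂ := dslope (dslope V 0) 0
  have hVW : ∀ g, V g = g ^ 2 * W g := by
    intro g
    have e1 := sub_smul_dslope V 0 g
    have e2 := sub_smul_dslope (dslope V 0) 0 g
    rw [dslope_same, hVd.deriv] at e2
    simp only [sub_zero, smul_eq_mul, hV0] at e1 e2
    rw [← e1, ← e2]
    ring
  have hG₀an : AnalyticAt ℂ G₀ 0 :=
    (analyticAt_id.mul hU₀).congr (hG₀.mono fun g hg => hg.symm)
  have hG₀d : deriv G₀ 0 ≠ 0 := by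
    rw [Filter.EventuallyEq.deriv_eq hG₀, ((hasDerivAt_id' (0 : ℂ)).fun_mul hd₀).deriv]
    simp [h₀]
  have hG₀0 : G₀ 0 = 0 := by rw [hG₀.self_of_nhds, zero_mul]
  -- Inverting `G₀` expresses the remainder in the effective coupling: `g³ W = G₀³ (W / U₀³)`,
  -- composed with the local inverse.
  have hφ := hG₀an.analyticAt_localInverse hG₀d
  have hleft := HasStrictFDerivAt.eventually_left_inverse
    (hG₀an.hasStrictDerivAt.hasStrictFDerivAt_equiv hG₀d)
  set φ := hG₀an.hasStrictDerivAt.localInverse _ _ _ hG₀d with hφdef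
  have hφ0 : φ (G₀ 0) = 0 := hleft.self_of_nhds
  rw [hG₀0] at hφ hφ0
  have hR : AnalyticAt ℂ (fun g => W g / U₀ g ^ 3) (φ 0) := by
    rw [hφ0]
    exact (hds (hds hVan)).div (hU₀.pow 3) (by simp [h₀])
  refine ⟨fun z => W (φ z) / U₀ (φ z) ^ 3, AnalyticAt.comp hR hφ, ?_⟩
  filter_upwards [hG₀, hG₁, hleft,
    hU₀.continuousAt.eventually_ne (by rw [h₀]; exact one_ne_zero)] with g h0 h1 h2 h3
  have h2 : φ (G₀ g) = g := h2
  simp only [h2]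
  have e := hVW g
  simp only [hV] at e
  rw [h0, h1]
  field_simp
  linear_combination g * e

end Expansion

end T45

end

/-! ### Assembly: signs, flow equation and rate of convergence -/

theorem mainTheorem1 (M : ℕ) (hM : 1 < M) (χ : ℝ → ℝ) (hχ : T45.IsBump χ)
    (mr : ℝ) (hmr : 0 < mr) :
    T45.betaTwo M χ < 0 ∧ T45.betaTwoUV M χ < 0 ∧
    ∃ (β : ℕ → ℤ → ℝ) (K : ℝ),
      (∀ jmax : ℕ,
        (∃ B : ℂ → T45.BareData, T45.IsMelonicFamily M χ jmax mr B) ∧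
        ∀ B : ℂ → T45.BareData, T45.IsMelonicFamily M χ jmax mr B →
          (∀ j : ℤ, -1 ≤ j → j ≤ jmax →
            (∀ᶠ g in 𝓝 (0 : ℂ), DifferentiableWithinAt ℝ
              ((B g).sigmaMrGe M χ jmax mr g (j + 1)) (Ici 0) 0) ∧
            AnalyticAt ℂ (T45.effZ M χ jmax mr B j) 0 ∧
            T45.effZ M χ jmax mr B j 0 = 1 ∧
            AnalyticAt ℂ (T45.effG M χ jmax mr B j) 0 ∧
            T45.effG M χ jmax mr B j 0 = 0 ∧
            deriv (T45.effG M χ jmax mr B j) 0 ≠ 0) ∧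
          (∀ j : ℤ, -1 ≤ j → j ≤ (jmax : ℤ) - 1 →
            ∃ f : ℂ → ℂ, AnalyticAt ℂ f 0 ∧
              ∀ᶠ g in 𝓝 (0 : ℂ),
                T45.effG M χ jmax mr B (j + 1) g - T45.effG M χ jmax mr B j g =
                  (β jmax j : ℂ) * T45.effG M χ jmax mr B j g ^ 2 +
                    T45.effG M χ jmax mr B j g ^ 3 * f (T45.effG M χ jmax mr B j g))) ∧
      (∀ (jmax : ℕ) (j : ℤ), -1 ≤ j → j ≤ (jmax : ℤ) - 2 →
        |β jmax j - T45.betaTwo M χ| ≤ K * (M : ℝ) ^ (-j)) ∧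
      (∀ jmax : ℕ,
        |β jmax ((jmax : ℤ) - 1) - T45.betaTwoUV M χ| ≤ K * (M : ℝ) ^ (-((jmax : ℤ) - 1))) := by
  obtain ⟨K, hK, hKUV⟩ := T45.exists_betaCoeff_bounds hM hχ mr
  refine ⟨?_, ?_, T45.betaCoeff M χ mr, K, fun jmax => ⟨T45.exists_melonicFamily hM hχ hmr jmax,
    fun B hB => ⟨fun j hj _ => ?_, fun j hj _ => ?_⟩⟩, hK, hKUV⟩
  · rw [T45.betaTwo_eq]
    exact T45.slicePoly_integral_neg hM hχ le_rfl
  · rw [T45.betaTwoUV_eq]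
    exact T45.slicePoly_integral_neg hM hχ zero_le_one
  · obtain ⟨h1, h2, U, hU, hU0, hUd, hG⟩ := hB.effective_expansion hM hχ hmr hj
    refine ⟨?_, h1, h2, ?_, ?_, ?_⟩
    · filter_upwards [hB.eventually_hasDerivWithinAt_sigmaMrGe hM hχ hmr (j := j + 1) (by omega)]
        with g hg using hg.differentiableWithinAt
    · exact (analyticAt_id.mul hU).congr (hG.mono fun g hg => hg.symm)
    · rw [hG.self_of_nhds, zero_mul]
    · rw [Filter.EventuallyEq.deriv_eq hG, ((hasDerivAt_id' (0 : ℂ)).fun_mul hUd).deriv]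
      simp [hU0]
  · obtain ⟨-, -, U₀, hU₀, h₀, hd₀, hG₀⟩ := hB.effective_expansion hM hχ hmr hj
    obtain ⟨-, -, U₁, hU₁, h₁, hd₁, hG₁⟩ :=
      hB.effective_expansion hM hχ hmr (j := j + 1) (by omega)
    have := T45.exists_flow_remainder hU₀ hU₁ h₀ h₁ hd₀ hd₁ hG₀ hG₁
    rw [T45.betaCoeff]
    push_cast
    exact this
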